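/- Let $G$ be a finite non-abelian group with center $Z(G)$, let $T$ be a transversal of $Z(G)$ in $G$, and let $\mathcal T(G)$ be the graph with vertex set $T\setminus Z(G)$ in which two distinct vertices $x,y$ are adjacent if and only if $xy=yx$ (up to isomorphism this graph does not depend on the choice of $T$). A graph is strongly regular with parameters $(v,k,\lambda,\mu)$, where $0<k<v-1$, if it has $v$ vertices, every vertex has exactly $k$ neighbours, any two adjacent vertices have exactly $\lambda$ common neighbours, and any two distinct non-adjacent vertices have exactly $\mu$ common neighbours. Two groups $G$ and $H$ are isoclinic if there are isomorphisms $\varphi:G/Z(G)\to H/Z(H)$ and $\psi:G'\to H'$ of the central quotients and of the derived subgroups such that $\psi([x,y])=[x',y']$ whenever $\varphi(xZ(G))=x'Z(H)$ and $\varphi(yZ(G))=y'Z(H)$. An extraspecial $2$-group is a finite non-abelian $2$-group $E$ with $E'=Z(E)=\Phi(E)$ and $|Z(E)|=2$, where $\Phi(E)$ is the Frattini subgroup. Then the graph $\mathcal T(G)$ is connected and strongly regular if and only if $G$ admits a decomposition $G=A\times P$ as an internal direct product, where $A$ is an abelian subgroup of $G$ and $P$ is a Sylow $2$-subgroup of $G$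 that is isoclinic to an extraspecial $2$-group of order $2^{2n+1}$ for some integer $n\ge 2$. In this case, the parameters of $\mathcal T(G)$ are $$(2^{2n}-1,\ 2^{2n-1}-2,\ 2^{2n-2}-3,\ 2^{2n-2}-1).$$ Moreover, $\mathcal T(G)$ is connected and strongly regular if and only if $G$ is isoclinic to an extraspecial $2$-group of order at least $32$. -/

import Mathlib

open scoped commutatorElement

/-- The commuting graph `C(G, X)`: the vertices are the elements of `X`, and two distinct vertices
are adjacent exactly when they commute. -/
def commutingGraph {G : Type*} [Group G] (X : Set G) : SimpleGraph X where
  Adj x y := x ≠ y ∧ (x : G) * y = y * x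
  symm := ⟨fun _ _ h => ⟨h.1.symm, h.2.symm⟩⟩
  loopless := ⟨fun _ h => h.1 rfl⟩

/-- The graph `T(G) = C(G, T \ Z(G))`, for a transversal `T` of the center `Z(G)` in `G`. -/
def transversalGraph {G : Type*} [Group G] (T : Set G) :
    SimpleGraph (T \ (Subgroup.center G : Set G) : Set G) :=
  commutingGraph (T \ (Subgroup.center G : Set G))

open Classical in
/-- Strongly regular graphs with parameters `(v, k, l, m)`, where `0 < k < v - 1`. -/
def IsStronglyRegular {V : Type*} [Finite V] (Γ : SimpleGraph V) (v k l m : ℕ) : Prop :=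
  letI := Fintype.ofFinite V
  0 < k ∧ k + 1 < v ∧ Γ.IsSRGWith v k l m

/-- The graph is connected and strongly regular, for some parameters. -/
def IsConnectedStronglyRegular {V : Type*} [Finite V] (Γ : SimpleGraph V) : Prop :=
  Γ.Connected ∧ ∃ v k l m : ℕ, IsStronglyRegular Γ v k l m

/-- The commutator map `G/Z(G) × G/Z(G) → G'`, `(xZ(G), yZ(G)) ↦ [x, y] = x y x⁻¹ y⁻¹`. -/
def commutatorMap (G : Type*) [Group G] (a b : G ⧸ Subgroup.center G) : commutator G :=
  Quotient.liftOn₂' a b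
    (fun x y => ⟨⁅x, y⁆, Subgroup.commutator_mem_commutator (Subgroup.mem_top x)
      (Subgroup.mem_top y)⟩)
    (by
      intro x y x' y' hx hy
      rw [QuotientGroup.leftRel_apply, Subgroup.mem_center_iff] at hx hy
      apply Subtype.ext
      obtain ⟨z, rfl⟩ : ∃ z, x' = x * z := ⟨x⁻¹ * x', by group⟩
      obtain ⟨w, rfl⟩ : ∃ w, y' = y * w := ⟨y⁻¹ * y', by group⟩
      simp only [inv_mul_cancel_left] at hx hy
      have hz : z ∈ Subgroup.center G := Subgroup.mem_center_iff.2 hx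
      have hw : w ∈ Subgroup.center G := Subgroup.mem_center_iff.2 hy
      change x * y * x⁻¹ * y⁻¹ = (x * z) * (y * w) * (x * z)⁻¹ * (y * w)⁻¹
      have e1 : (x * z) * (y * w) = x * y * (w * z) := by
        rw [mul_assoc x z, ← hx (y * w)]; simp only [mul_assoc]
      have e2 : (x * z)⁻¹ * (y * w)⁻¹ = (w * z)⁻¹ * (x⁻¹ * y⁻¹) := by
        rw [← mul_inv_rev, ← mul_inv_rev, ← mul_inv_rev]
        congr 1
        rw [mul_assoc y w, ← hy (x * z)]; simp only [mul_assoc]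
        rw [hx w]
      rw [mul_assoc _ _ (y * w)⁻¹, e2, e1]
      group)

theorem commutatorMap_mk {G : Type*} [Group G] (x y : G) :
    (commutatorMap G (x : G ⧸ Subgroup.center G) (y : G ⧸ Subgroup.center G) : G) = ⁅x, y⁆ :=
  rfl

/-- An isoclinism from `G` to `H`: a pair of isomorphisms `G/Z(G) ≃ H/Z(H)` and `G' ≃ H'` that is
compatible with the commutator maps. -/
structure Isoclinism (G H : Type*) [Group G] [Group H] where
  φ : (G ⧸ Subgroup.center G) ≃* (H ⧸ Subgroup.center H)
  ψ : commutator G ≃* commutator H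
  map_commutator : ∀ a b : G ⧸ Subgroup.center G,
    ψ (commutatorMap G a b) = commutatorMap H (φ a) (φ b)

/-- The groups `G` and `H` are isoclinic. -/
def Isoclinic (G H : Type*) [Group G] [Group H] : Prop :=
  Nonempty (Isoclinism G H)

/-- `E` is an extraspecial `p`-group: a finite non-abelian `p`-group with `E' = Z(E) = Φ(E)` and
`|Z(E)| = p`. -/
structure IsExtraspecial (p : ℕ) (E : Type*) [Group E] : Prop where
  prime : p.Prime
  finite : Finite E
  isPGroup : IsPGroup p E
  nonabelian : ∃ x y : E, x * y ≠ y * x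
  commutator_eq_center : commutator E = Subgroup.center E
  center_eq_frattini : Subgroup.center E = frattini E
  card_center : Nat.card (Subgroup.center E) = p

/-- `G = H × K` as an internal direct product of subgroups. -/
structure IsInternalDirectProduct {G : Type*} [Group G] (H K : Subgroup G) : Prop where
  normal_left : H.Normal
  normal_right : K.Normal
  inf_eq_bot : H ⊓ K = ⊥
  sup_eq_top : H ⊔ K = ⊤

/-- `G = A × P` with `A` an abelian subgroup and `P` a Sylow `2`-subgroup of `G` that is isoclinic
to an extraspecial `2`-group of order `2 ^ (2 * n + 1)`. Finite groups all have isomorphic copies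
in `Type`, so `E : Type` is no restriction. -/
def HasExtraspecialDecomposition (G : Type*) [Group G] (n : ℕ) : Prop :=
  ∃ (A : Subgroup G) (P : Sylow 2 G),
    (∀ a ∈ A, ∀ b ∈ A, a * b = b * a) ∧
    IsInternalDirectProduct A (P : Subgroup G) ∧
    ∃ (E : Type) (_ : Group E),
      IsExtraspecial 2 E ∧ Nat.card E = 2 ^ (2 * n + 1) ∧ Isoclinic (P : Subgroup G) E

/-! Write Z for the center. A transversal meets every coset of Z once, so valencies and numbers of
common neighbours are, up to small shifts, orders of subgroups divided by |Z|: |G| = (v+1)|Z|,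
|C(x)| = (k+2)|Z|, and |C(x) ∩ C(y)| is (λ+3)|Z| or (μ+1)|Z| according as x and y are adjacent or
not (`isStronglyRegular_transversalGraph_iff`). All the conditions in the theorem are then reduced
to |G'| = 2 together with |G/Z| ≥ 16.

Suppose the graph is connected and strongly regular. Comparing x with x⁻¹ shows that G/Z has
exponent 2, so c = k+2, e = λ+3, d = μ+1 and q = v+1 are powers of 2. The identity k(k-λ-1) =
(v-k-1)μ then leaves two cases (`eq_of_two_pow_param_eq`). If q = 2c = 4e, noncentral centralizers
have index 2, which makes all nontrivial commutators equal. If c = 2e, d = 2 and q = ec, a count of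
abelian intersections of centralizers gives e ≤ 4, hence the parameters (31, 6, 1, 1), which a trace
computation modulo 5 excludes.

Conversely, let |G'| = 2. The commutator is a nondegenerate alternating form on the 𝔽₂-space G/Z.
Distinct nontrivial cosets of Z have distinct centralizers of index 2, which meet in index 4; this
gives the parameters and, once |G/Z| ≥ 16, connectedness. The form determines G up to isoclinism,
its dimension is even, and it is the commutator form of an extraspecial group built from a bilinear
cocycle (`exists_isExtraspecial_isoclinic`). Squares are central, so elements of odd order are
central, and G splits as an abelian group times a Sylow 2-subgroup. -/

open Classical in
theorem isStronglyRegular_iff {V : Type*} [Finite V] (Γ : SimpleGraph V) (v k l m : ℕ) :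
    IsStronglyRegular Γ v k l m ↔ 0 < k ∧ k + 1 < v ∧ Nat.card V = v ∧
      (∀ x, (Γ.neighborSet x).ncard = k) ∧
      (∀ x y, Γ.Adj x y → (Γ.commonNeighbors x y).ncard = l) ∧
      (∀ x y, x ≠ y → ¬ Γ.Adj x y → (Γ.commonNeighbors x y).ncard = m) := by
  let _ := Fintype.ofFinite V
  have hn : ∀ x, (Γ.neighborSet x).ncard = Γ.degree x := by
    intro x
    rw [← Γ.card_neighborSet_eq_degree, Set.ncard_eq_toFinset_card', Set.toFinset_card]
  have hc : ∀ x y, (Γ.commonNeighbors x y).ncard = Fintype.card (Γ.commonNeighbors x y) := by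
    intro x y
    rw [Set.ncard_eq_toFinset_card', Set.toFinset_card]
  simp only [hn, hc, Nat.card_eq_fintype_card]
  constructor
  · rintro ⟨h1, h2, h3⟩
    refine ⟨h1, h2, ?_, ?_, ?_, ?_⟩
    · convert h3.card
    · intro x
      convert h3.regular x
    · intro x y hxy
      convert h3.of_adj x y hxy
    · intro x y hne hxy
      convert h3.of_not_adj hne hxy
  · rintro ⟨h1, h2, h3, h4, h5, h6⟩
    refine ⟨h1, h2, ?_, ?_, ?_, ?_⟩
    · convert h3
    · intro x
      convert h4 x
    · intro x y hxy
      convert h5 x y hxy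
    · intro x y hne hxy
      convert h6 x y hne hxy

/-! ### The graph in terms of orders of centralizers -/

section Centralizers

variable {G : Type*} [Group G]

theorem center_le_centralizer_singleton (g : G) :
    Subgroup.center G ≤ Subgroup.centralizer {g} :=
  Subgroup.center_le_centralizer _

theorem mem_centralizer_singleton_iff_commute {g h : G} :
    h ∈ Subgroup.centralizer {g} ↔ g * h = h * g := by
  rw [Subgroup.mem_centralizer_singleton_iff, eq_comm]

theorem centralizer_singleton_eq_of_inv_mul_mem_center {x g : G}
    (h : x⁻¹ * g ∈ Subgroup.center G) :
    Subgroup.centralizer {x} = Subgroup.centralizer {g} := by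
  obtain ⟨z, rfl⟩ : ∃ z, g = x * z := ⟨x⁻¹ * g, by group⟩
  rw [inv_mul_cancel_left] at h
  have hz := Subgroup.mem_center_iff.1 h
  ext y
  rw [mem_centralizer_singleton_iff_commute, mem_centralizer_singleton_iff_commute,
    mul_assoc, ← hz y, ← mul_assoc, ← mul_assoc, mul_left_inj]

theorem notMem_center_of_inv_mul_mem {x g : G} (h : x⁻¹ * g ∈ Subgroup.center G)
    (hg : g ∉ Subgroup.center G) : x ∉ Subgroup.center G := by
  intro hx
  exact hg (by simpa using mul_mem hx h)

/-- As K ≤ H, the subgroup H is a union of cosets tK, and their representatives t are exactly the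
elements of T lying in H. -/
theorem IsComplement.ncard_inter_mul [Finite G] {K : Subgroup G} {T : Set G}
    (hT : Subgroup.IsComplement T (K : Set G)) (H : Subgroup G) (hH : K ≤ H) :
    (T ∩ H).ncard * Nat.card K = Nat.card H := by
  rw [← Nat.card_coe_set_eq, ← Nat.card_prod]
  refine Nat.card_congr (Equiv.ofBijective
    (fun p : (T ∩ H : Set G) × K => (⟨p.1 * p.2, H.mul_mem p.1.2.2 (hH p.2.2)⟩ : H)) ⟨?_, ?_⟩)
  · rintro ⟨⟨a, ha⟩, b⟩ ⟨⟨c, hc⟩, d⟩ h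
    have := @hT.1 (⟨a, ha.1⟩, b) (⟨c, hc.1⟩, d) (congrArg Subtype.val h)
    simp only [Prod.mk.injEq, Subtype.mk.injEq] at this ⊢
    exact this
  · rintro ⟨y, hy⟩
    obtain ⟨⟨⟨a, ha⟩, b⟩, hab⟩ := hT.2 y
    simp only at hab
    refine ⟨(⟨a, ha, ?_⟩, b), Subtype.ext hab⟩
    have : a = y * (b : G)⁻¹ := by rw [← hab]; group
    rw [this]
    exact H.mul_mem hy (H.inv_mem (hH b.2))

/-- The `+ 1` is the representative of the coset K itself, which need not be the identity. -/
theorem IsComplement.ncard_diff_inter_add_one_mul [Finite G] {K : Subgroup G} {T : Set G}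
    (hT : Subgroup.IsComplement T (K : Set G)) (H : Subgroup G) (hH : K ≤ H) :
    (((T \ (K : Set G)) ∩ H).ncard + 1) * Nat.card K = Nat.card H := by
  have hK : (T ∩ K).ncard = 1 := by
    have := IsComplement.ncard_inter_mul hT K le_rfl
    exact Nat.eq_of_mul_eq_mul_right Nat.card_pos (by rw [this, one_mul])
  rw [← IsComplement.ncard_inter_mul hT H hH, ← hK,
    ← Set.ncard_union_eq (Set.disjoint_left.2 fun x hx hx' => hx.1.2 hx'.2)
      (Set.toFinite _) (Set.toFinite _)]
  congr 2
  ext x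
  have : x ∈ K → x ∈ H := fun h => hH h
  simp only [Set.mem_union, Set.mem_inter_iff, Set.mem_sdiff, SetLike.mem_coe]
  tauto

variable {T : Set G}

theorem exists_mem_transversal
    (hT : Subgroup.IsComplement T (Subgroup.center G : Set G)) (g : G) (hg : g ∉ Subgroup.center G) :
    ∃ x ∈ T \ (Subgroup.center G : Set G), x⁻¹ * g ∈ Subgroup.center G := by
  obtain ⟨⟨⟨a, ha⟩, b⟩, hab⟩ := hT.2 g
  simp only at hab
  have h : a⁻¹ * g ∈ Subgroup.center G := by rw [← hab]; simp
  exact ⟨a, ⟨ha, notMem_center_of_inv_mul_mem h hg⟩, h⟩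

theorem eq_of_mem_transversal
    (hT : Subgroup.IsComplement T (Subgroup.center G : Set G)) {x y : G} (hx : x ∈ T) (hy : y ∈ T)
    (h : x⁻¹ * y ∈ Subgroup.center G) : x = y := by
  have := @hT.1 (⟨x, hx⟩, ⟨x⁻¹ * y, h⟩) (⟨y, hy⟩, 1) (by simp)
  simp only [Prod.mk.injEq, Subtype.mk.injEq] at this
  exact this.1

/-- Among the cosets of the center inside the centralizer, the central one and that of x are not
neighbours, whence `+ 2`. For adjacent x, y the same count excludes three cosets; for noncommuting
x, y only the central one, as neither x nor y lies in the common centralizer. -/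
theorem ncard_neighborSet_transversalGraph
    (hT : Subgroup.IsComplement T (Subgroup.center G : Set G)) [Finite G]
    (x : (T \ (Subgroup.center G : Set G) : Set G)) :
    (((transversalGraph T).neighborSet x).ncard + 2) * Nat.card (Subgroup.center G) =
      Nat.card (Subgroup.centralizer {(x : G)}) := by
  rw [← IsComplement.ncard_diff_inter_add_one_mul hT _ (center_le_centralizer_singleton _),
    ← Set.ncard_image_of_injective _ Subtype.val_injective]
  have hx : (x : G) ∈ (T \ (Subgroup.center G : Set G)) ∩ Subgroup.centralizer {(x : G)} :=
    ⟨x.2, mem_centralizer_singleton_iff_commute.2 rfl⟩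
  rw [← Set.ncard_sdiff_singleton_add_one hx, add_assoc _ 1 1, one_add_one_eq_two]
  congr 3
  ext y
  simp only [Set.mem_image, SimpleGraph.mem_neighborSet, Set.mem_sdiff, Set.mem_inter_iff,
    SetLike.mem_coe, mem_centralizer_singleton_iff_commute, Set.mem_singleton_iff]
  constructor
  · rintro ⟨y, hy, rfl⟩
    exact ⟨⟨y.2, hy.2⟩, fun h => hy.1 (Subtype.ext h.symm)⟩
  · rintro ⟨⟨hy, hc⟩, hne⟩
    exact ⟨⟨y, hy⟩, ⟨fun h => hne (congrArg Subtype.val h).symm, hc⟩, rfl⟩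

theorem ncard_commonNeighbors_transversalGraph_of_adj
    (hT : Subgroup.IsComplement T (Subgroup.center G : Set G)) [Finite G]
    (x y : (T \ (Subgroup.center G : Set G) : Set G)) (h : (transversalGraph T).Adj x y) :
    (((transversalGraph T).commonNeighbors x y).ncard + 3) * Nat.card (Subgroup.center G) =
      Nat.card (Subgroup.centralizer {(x : G)} ⊓ Subgroup.centralizer {(y : G)} : Subgroup G) := by
  rw [← IsComplement.ncard_diff_inter_add_one_mul hT _
    (le_inf (center_le_centralizer_singleton _) (center_le_centralizer_singleton _)),
    ← Set.ncard_image_of_injective _ Subtype.val_injective]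
  have hne : (x : G) ≠ y := fun e => h.1 (Subtype.ext e)
  have hs : ({(x : G), (y : G)} : Set G) ⊆ (T \ (Subgroup.center G : Set G)) ∩
      (Subgroup.centralizer {(x : G)} ⊓ Subgroup.centralizer {(y : G)} : Subgroup G) := by
    rintro _ (rfl | rfl)
    · exact ⟨x.2, mem_centralizer_singleton_iff_commute.2 rfl,
        mem_centralizer_singleton_iff_commute.2 h.2.symm⟩
    · exact ⟨y.2, mem_centralizer_singleton_iff_commute.2 h.2,
        mem_centralizer_singleton_iff_commute.2 rfl⟩
  rw [← Set.ncard_sdiff_add_ncard_of_subset hs, Set.ncard_pair hne, add_assoc _ 2 1, two_add_one_eq_three]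
  congr 3
  ext u
  simp only [Set.mem_image, SimpleGraph.mem_commonNeighbors, Set.mem_sdiff, Set.mem_inter_iff,
    SetLike.mem_coe, Subgroup.mem_inf, mem_centralizer_singleton_iff_commute,
    Set.mem_singleton_iff, Set.mem_insert_iff, not_or]
  constructor
  · rintro ⟨u, hu, rfl⟩
    exact ⟨⟨u.2, hu.1.2, hu.2.2⟩, fun h => hu.1.1 (Subtype.ext h.symm),
      fun h => hu.2.1 (Subtype.ext h.symm)⟩
  · rintro ⟨⟨hu, hc, hc'⟩, hne, hne'⟩
    exact ⟨⟨u, hu⟩, ⟨⟨fun h => hne (congrArg Subtype.val h).symm, hc⟩,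
      ⟨fun h => hne' (congrArg Subtype.val h).symm, hc'⟩⟩, rfl⟩

theorem ncard_commonNeighbors_transversalGraph_of_not_commute
    (hT : Subgroup.IsComplement T (Subgroup.center G : Set G)) [Finite G]
    (x y : (T \ (Subgroup.center G : Set G) : Set G)) (h : (x : G) * y ≠ y * x) :
    (((transversalGraph T).commonNeighbors x y).ncard + 1) * Nat.card (Subgroup.center G) =
      Nat.card (Subgroup.centralizer {(x : G)} ⊓ Subgroup.centralizer {(y : G)} : Subgroup G) := by
  rw [← IsComplement.ncard_diff_inter_add_one_mul hT _
    (le_inf (center_le_centralizer_singleton _) (center_le_centralizer_singleton _)),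
    ← Set.ncard_image_of_injective _ Subtype.val_injective]
  congr 3
  ext u
  simp only [Set.mem_image, SimpleGraph.mem_commonNeighbors, Set.mem_sdiff, Set.mem_inter_iff,
    SetLike.mem_coe, Subgroup.mem_inf, mem_centralizer_singleton_iff_commute]
  constructor
  · rintro ⟨u, hu, rfl⟩
    exact ⟨u.2, hu.1.2, hu.2.2⟩
  · rintro ⟨hu, hc, hc'⟩
    refine ⟨⟨u, hu⟩, ⟨⟨?_, hc⟩, ⟨?_, hc'⟩⟩, rfl⟩
    · rintro rfl
      exact h hc'.symm
    · rintro rfl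
      exact h hc

/-- The parameters of the graph, in terms of the orders of centralizers. -/
theorem isStronglyRegular_transversalGraph_iff
    (hT : Subgroup.IsComplement T (Subgroup.center G : Set G)) [Finite G] (v k l m : ℕ) :
    IsStronglyRegular (transversalGraph T) v k l m ↔ 0 < k ∧ k + 1 < v ∧
      Nat.card G = (v + 1) * Nat.card (Subgroup.center G) ∧
      (∀ g : G, g ∉ Subgroup.center G →
        Nat.card (Subgroup.centralizer {g}) = (k + 2) * Nat.card (Subgroup.center G)) ∧
      (∀ g h : G, g ∉ Subgroup.center G → h ∉ Subgroup.center G → g⁻¹ * h ∉ Subgroup.center G →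
        g * h = h * g →
        Nat.card (Subgroup.centralizer {g} ⊓ Subgroup.centralizer {h} : Subgroup G) =
          (l + 3) * Nat.card (Subgroup.center G)) ∧
      (∀ g h : G, g * h ≠ h * g →
        Nat.card (Subgroup.centralizer {g} ⊓ Subgroup.centralizer {h} : Subgroup G) =
          (m + 1) * Nat.card (Subgroup.center G)) := by
  have hz : 0 < Nat.card (Subgroup.center G) := Nat.card_pos
  have hadj : ∀ x y : (T \ (Subgroup.center G : Set G) : Set G),
      (transversalGraph T).Adj x y ↔ x ≠ y ∧ (x : G) * y = y * x := fun _ _ => Iff.rfl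
  rw [isStronglyRegular_iff]
  refine and_congr_right fun _ => and_congr_right fun _ => and_congr ?_ (and_congr ?_
    (and_congr ?_ ?_))
  · have := IsComplement.ncard_diff_inter_add_one_mul hT ⊤ le_top
    rw [Subgroup.coe_top, Set.inter_univ, Subgroup.card_top] at this
    rw [Nat.card_coe_set_eq, ← this, Nat.mul_left_inj hz.ne', Nat.add_right_cancel_iff]
  · constructor
    · intro H g hg
      obtain ⟨x, hx, hxg⟩ := exists_mem_transversal hT g hg
      rw [← centralizer_singleton_eq_of_inv_mul_mem_center hxg,
        ← ncard_neighborSet_transversalGraph hT ⟨x, hx⟩, H]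
    · intro H x
      have := ncard_neighborSet_transversalGraph hT x
      rw [H _ x.2.2, Nat.mul_left_inj hz.ne'] at this
      omega
  · constructor
    · intro H g h hg hh hgh hc
      obtain ⟨x, hx, hxg⟩ := exists_mem_transversal hT g hg
      obtain ⟨y, hy, hyh⟩ := exists_mem_transversal hT h hh
      have ex := centralizer_singleton_eq_of_inv_mul_mem_center hxg
      have ey := centralizer_singleton_eq_of_inv_mul_mem_center hyh
      have hxy : (transversalGraph T).Adj ⟨x, hx⟩ ⟨y, hy⟩ := by
        refine ⟨?_, ?_⟩
        · intro e
          obtain rfl : x = y := congrArg Subtype.val e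
          apply hgh
          have := mul_mem (inv_mem hxg) hyh
          simpa [mul_assoc] using this
        · have h1 : h ∈ Subgroup.centralizer {x} := by
            rw [ex]; exact mem_centralizer_singleton_iff_commute.2 hc
          have h2 : x ∈ Subgroup.centralizer {y} := by
            rw [ey]
            exact mem_centralizer_singleton_iff_commute.2
              (mem_centralizer_singleton_iff_commute.1 h1).symm
          exact (mem_centralizer_singleton_iff_commute.1 h2).symm
      rw [← ex, ← ey, ← ncard_commonNeighbors_transversalGraph_of_adj hT ⟨x, hx⟩ ⟨y, hy⟩ hxy,
        H _ _ hxy]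
    · intro H x y hxy
      have := ncard_commonNeighbors_transversalGraph_of_adj hT x y hxy
      rw [H _ _ x.2.2 y.2.2 (fun h => hxy.1 (Subtype.ext
        (eq_of_mem_transversal hT x.2.1 y.2.1 h))) hxy.2, Nat.mul_left_inj hz.ne'] at this
      omega
  · constructor
    · intro H g h hgh
      have hg : g ∉ Subgroup.center G := fun hg =>
        hgh (Subgroup.mem_center_iff.1 hg h).symm
      have hh : h ∉ Subgroup.center G := fun hh => hgh (Subgroup.mem_center_iff.1 hh g)
      obtain ⟨x, hx, hxg⟩ := exists_mem_transversal hT g hg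
      obtain ⟨y, hy, hyh⟩ := exists_mem_transversal hT h hh
      have ex := centralizer_singleton_eq_of_inv_mul_mem_center hxg
      have ey := centralizer_singleton_eq_of_inv_mul_mem_center hyh
      have hxy : x * y ≠ y * x := by
        intro hc
        apply hgh
        have h1 : y ∈ Subgroup.centralizer {g} := by
          rw [← ex]; exact mem_centralizer_singleton_iff_commute.2 hc
        have h2 : g ∈ Subgroup.centralizer {h} := by
          rw [← ey]
          exact mem_centralizer_singleton_iff_commute.2
            (mem_centralizer_singleton_iff_commute.1 h1).symm
        exact (mem_centralizer_singleton_iff_commute.1 h2).symm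
      rw [← ex, ← ey,
        ← ncard_commonNeighbors_transversalGraph_of_not_commute hT ⟨x, hx⟩ ⟨y, hy⟩ hxy,
        H _ _ (fun e => hxy (by rw [show x = y from congrArg Subtype.val e])) (fun e => hxy e.2)]
    · intro H x y hne hxy
      have hc : (x : G) * y ≠ y * x := fun hc => hxy ⟨hne, hc⟩
      have := ncard_commonNeighbors_transversalGraph_of_not_commute hT x y hc
      rw [H _ _ hc, Nat.mul_left_inj hz.ne'] at this
      omega

/-- If the graph is connected, then commuting is not transitive on noncentral elements. -/
theorem exists_commuting_path_of_connected
    (hT : Subgroup.IsComplement T (Subgroup.center G : Set G)) (hG : ∃ x y : G, x * y ≠ y * x)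
    (hc : (transversalGraph T).Connected) :
    ∃ g h i : G, h ∉ Subgroup.center G ∧ g * h = h * g ∧ h * i = i * h ∧ g * i ≠ i * g := by
  by_contra! hcon
  obtain ⟨a, b, hab⟩ := hG
  -- By `hcon`, commuting passes through any noncentral element, so it propagates along walks.
  have hall : ∀ x y : (T \ (Subgroup.center G : Set G) : Set G), (x : G) * y = y * x := by
    intro x y
    obtain ⟨p⟩ := hc.preconnected x y
    induction p with
    | nil => rfl
    | @cons u v w huv p ih => exact hcon _ v _ v.2.2 huv.2 ih
  have ha : a ∉ Subgroup.center G := fun ha => hab (Subgroup.mem_center_iff.1 ha b).symm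
  have hb : b ∉ Subgroup.center G := fun hb => hab (Subgroup.mem_center_iff.1 hb a)
  obtain ⟨x, hx, hxa⟩ := exists_mem_transversal hT a ha
  obtain ⟨y, hy, hyb⟩ := exists_mem_transversal hT b hb
  have h1 : y ∈ Subgroup.centralizer {a} := by
    rw [← centralizer_singleton_eq_of_inv_mul_mem_center hxa]
    exact mem_centralizer_singleton_iff_commute.2 (hall ⟨x, hx⟩ ⟨y, hy⟩)
  have h2 : a ∈ Subgroup.centralizer {b} := by
    rw [← centralizer_singleton_eq_of_inv_mul_mem_center hyb]
    exact mem_centralizer_singleton_iff_commute.2 (mem_centralizer_singleton_iff_commute.1 h1).symm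
  exact hab (mem_centralizer_singleton_iff_commute.1 h2).symm

theorem transversalGraph_connected
    (hT : Subgroup.IsComplement T (Subgroup.center G : Set G)) (hG : ∃ x y : G, x * y ≠ y * x)
    (h : ∀ g h : G, g * h ≠ h * g → ∃ i, i ∉ Subgroup.center G ∧ g * i = i * g ∧ h * i = i * h) :
    (transversalGraph T).Connected := by
  have hcomm : ∀ x y : (T \ (Subgroup.center G : Set G) : Set G), (x : G) * y = y * x →
      (transversalGraph T).Reachable x y := by
    intro x y hxy
    by_cases e : x = y
    · rw [e]
    · exact SimpleGraph.Adj.reachable ⟨e, hxy⟩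
  obtain ⟨a, b, hab⟩ := hG
  have ha : a ∉ Subgroup.center G := fun ha => hab (Subgroup.mem_center_iff.1 ha b).symm
  obtain ⟨x, hx, -⟩ := exists_mem_transversal hT a ha
  have : Nonempty (T \ (Subgroup.center G : Set G) : Set G) := ⟨⟨x, hx⟩⟩
  refine SimpleGraph.Connected.mk fun x y => ?_
  by_cases hxy : (x : G) * y = y * x
  · exact hcomm x y hxy
  · obtain ⟨i, hi, hxi, hyi⟩ := h x y hxy
    obtain ⟨j, hj, hji⟩ := exists_mem_transversal hT i hi
    have ej := centralizer_singleton_eq_of_inv_mul_mem_center hji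
    have h1 : (x : G) ∈ Subgroup.centralizer {j} := by
      rw [ej]; exact mem_centralizer_singleton_iff_commute.2 hxi.symm
    have h2 : (y : G) ∈ Subgroup.centralizer {j} := by
      rw [ej]; exact mem_centralizer_singleton_iff_commute.2 hyi.symm
    exact (hcomm x ⟨j, hj⟩ (mem_centralizer_singleton_iff_commute.1 h1).symm).trans
      (hcomm ⟨j, hj⟩ y (mem_centralizer_singleton_iff_commute.1 h2))

end Centralizers

/-! ### Numerical restrictions on the parameters -/

open Classical in
-- Here A² = 6I + A + Ā = 5I + J, where Ā is the adjacency matrix of the complement, and AJ = 6J.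
-- Modulo 5 this reads A² = J and AJ = J, so A⁵ = J has trace 31 = 1. But in characteristic 5 the
-- trace of A⁵ is the fifth power of the trace of A, which is 0.
theorem not_isSRGWith_31_6_1_1 {V : Type*} [Fintype V] (Γ : SimpleGraph V) :
    ¬ Γ.IsSRGWith 31 6 1 1 := by
  have h31 : ¬ ((31 : ℕ) • (1 : ZMod 5) = 0 ^ 5) := by decide
  intro h
  set A := Γ.adjMatrix (ZMod 5)
  set J : Matrix V V (ZMod 5) := Matrix.of 1 with hJ
  have hsq : A ^ 2 = J := by
    have h1 := h.matrix_eq (α := ZMod 5)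
    have h2 : (1 : Matrix V V (ZMod 5)) + A + Γᶜ.adjMatrix (ZMod 5) = J := by
      ext i j
      by_cases hij : i = j
      · subst hij; simp [A, hJ]
      · by_cases hadj : Γ.Adj i j <;> simp [A, hJ, hij, hadj]
    have h3 : (6 : ℕ) • (1 : Matrix V V (ZMod 5)) = 1 := by
      rw [← Nat.cast_smul_eq_nsmul (ZMod 5), show ((6 : ℕ) : ZMod 5) = 1 from rfl, one_smul]
    rw [h1, h3, one_smul, one_smul, h2]
  have hAJ : A * J = J := by
    ext i j
    rw [SimpleGraph.adjMatrix_mul_apply]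
    simp only [hJ, Matrix.of_apply, Pi.one_apply, Finset.sum_const, nsmul_eq_mul, mul_one]
    rw [SimpleGraph.card_neighborFinset_eq_degree, h.regular i]
    rfl
  have h5 : A ^ 5 = J := by
    rw [show A ^ 5 = A * (A * (A * A ^ 2)) by simp only [pow_succ, mul_assoc, pow_zero, one_mul],
      hsq, hAJ, hAJ, hAJ]
  have : Fact (Nat.Prime 5) := ⟨by norm_num⟩
  have ht := ZMod.trace_pow_card A
  rw [h5, SimpleGraph.trace_adjMatrix] at ht
  simp only [Matrix.trace, hJ, Matrix.diag_apply, Matrix.of_apply, Pi.one_apply, Finset.sum_const,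
    Finset.card_univ, h.card] at ht
  exact h31 ht

theorem not_isStronglyRegular_31_6_1_1 {V : Type*} [Finite V] (Γ : SimpleGraph V) :
    ¬ IsStronglyRegular Γ 31 6 1 1 := by
  rintro ⟨-, -, h⟩
  let _ := Fintype.ofFinite V
  exact not_isSRGWith_31_6_1_1 Γ (by convert h)

open Classical in
theorem IsStronglyRegular.param_eq {V : Type*} [Finite V] {Γ : SimpleGraph V} {v k l m : ℕ}
    (h : IsStronglyRegular Γ v k l m) : k * (k - l - 1) = (v - k - 1) * m := by
  obtain ⟨-, h2, h3⟩ := h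
  let _ := Fintype.ofFinite V
  exact h3.param_eq _ (by omega)

/-- Used with c = k+2, e = λ+3, d = μ+1, q = v+1. Put e = 2^t, c = 2^(t+a), q = 2^(t+a+b), d = 2^u.
Dividing by 2^t and reducing modulo 2^a gives 2^a ∣ 2, so a = 1. What remains is 2^t - 1 = (2^b -
1)(2^u - 1) with t ≥ 2, and modulo 4 this forces b = 1 or u = 1. -/
theorem eq_of_two_pow_param_eq {c e d q : ℕ} (hc : ∃ i, c = 2 ^ i) (he : ∃ i, e = 2 ^ i)
    (hd : ∃ i, d = 2 ^ i) (hq : ∃ i, q = 2 ^ i) (h1 : 4 ≤ e) (h2 : e < c) (h3 : c < q)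
    (h4 : 2 ≤ d) (h : (c - 2) * (c - e) = (q - c) * (d - 1)) :
    c = 2 * e ∧ (q = 2 * c ∨ d = 2 ∧ q = e * c) := by
  obtain ⟨i, rfl⟩ := hc
  obtain ⟨t, rfl⟩ := he
  obtain ⟨u, rfl⟩ := hd
  obtain ⟨n, rfl⟩ := hq
  have hti : t < i := (Nat.pow_lt_pow_iff_right (by norm_num)).1 h2
  have hin : i < n := (Nat.pow_lt_pow_iff_right (by norm_num)).1 h3
  have ht : 2 ≤ t := by
    by_contra hlt
    interval_cases t <;> omega
  have hu : 1 ≤ u := by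
    by_contra hlt
    interval_cases u; omega
  obtain ⟨a, rfl⟩ : ∃ a, i = t + a := ⟨i - t, by omega⟩
  obtain ⟨b, rfl⟩ : ∃ b, n = t + a + b := ⟨n - (t + a), by omega⟩
  have hpos : ∀ x : ℕ, 1 ≤ 2 ^ x := fun x => Nat.one_le_two_pow
  have hz : ((2 : ℤ) ^ t * 2 ^ a - 2) * (2 ^ a - 1) = 2 ^ a * (2 ^ b - 1) * (2 ^ u - 1) := by
    zify [h2.le, h3.le, hpos u, show 2 ≤ 2 ^ (t + a) by omega] at h
    have hne : (2 : ℤ) ^ t ≠ 0 := by positivity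
    apply mul_left_cancel₀ hne
    rw [pow_add, pow_add] at h
    rw [pow_add] at h
    linear_combination h
  have hdvd : (2 : ℤ) ^ a ∣ 2 :=
    ⟨(2 ^ b - 1) * (2 ^ u - 1) - 2 ^ t * (2 ^ a - 1) + 2, by linear_combination hz⟩
  have ha : a = 1 := by
    have h2a : (2 : ℤ) ^ a ≤ 2 := Int.le_of_dvd (by norm_num) hdvd
    have : (2 : ℤ) ^ a ≤ 2 ^ 1 := by simpa using h2a
    have := (pow_le_pow_iff_right₀ (by norm_num : (1 : ℤ) < 2)).1 this
    omega
  subst ha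
  have hz' : (2 : ℤ) ^ t - 1 = (2 ^ b - 1) * (2 ^ u - 1) := by linarith
  refine ⟨by ring, ?_⟩
  by_cases hb : b = 1
  · left; subst hb; ring
  · by_cases hu1 : u = 1
    · right
      subst hu1
      have hz2 : (2 : ℤ) ^ t = 2 ^ b := by linarith
      have hz3 : 2 ^ t = 2 ^ b := by exact_mod_cast hz2
      exact ⟨rfl, by rw [pow_add _ (t + 1) b, ← hz3, mul_comm]⟩
    · exfalso
      obtain ⟨b', rfl⟩ : ∃ b', b = b' + 2 := ⟨b - 2, by omega⟩
      obtain ⟨u', rfl⟩ : ∃ u', u = u' + 2 := ⟨u - 2, by omega⟩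
      -- Modulo 4 the left side of `hz'` is now -1 and the right side is 1.
      obtain ⟨t', rfl⟩ : ∃ t', t = t' + 2 := ⟨t - 2, by omega⟩
      have hd4 : (4 : ℤ) ∣ 2 := by
        refine ⟨2 ^ t' - 4 * 2 ^ b' * 2 ^ u' + 2 ^ b' + 2 ^ u', ?_⟩
        rw [pow_add, pow_add, pow_add] at hz'
        linear_combination -hz'
      norm_num at hd4

/-! ### From strong regularity to a derived subgroup of order 2 -/

section

variable {G : Type*} [Group G]

theorem Subgroup.card_mul_relIndex_of_le {H K : Subgroup G} (h : H ≤ K) :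
    Nat.card H * H.relIndex K = Nat.card K := by
  rw [← Subgroup.relIndex_bot_left, ← Subgroup.relIndex_bot_left,
    Subgroup.relIndex_mul_relIndex _ _ _ bot_le h]

theorem Subgroup.inv_mul_mem_of_card_eq_two_mul [Finite G] {H K : Subgroup G} (h : H ≤ K)
    (hc : Nat.card K = 2 * Nat.card H) {x y : G} (hx : x ∈ K) (hy : y ∈ K) (hx' : x ∉ H)
    (hy' : y ∉ H) : x⁻¹ * y ∈ H := by
  have h2 : (H.subgroupOf K).index = 2 := by
    have := Subgroup.card_mul_relIndex_of_le h
    rw [hc, mul_comm] at this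
    exact Nat.eq_of_mul_eq_mul_right Nat.card_pos this
  have := (Subgroup.mul_mem_iff_of_index_two h2 (a := ⟨x, hx⟩⁻¹) (b := ⟨y, hy⟩)).2
  simp only [inv_mem_iff, Subgroup.mem_subgroupOf, hx', hy', iff_self, true_imp_iff] at this
  exact this

theorem exists_card_eq_two_pow_mul_card_center [Finite G]
    (hsq : ∀ x : G, x * x ∈ Subgroup.center G) (H : Subgroup G) (hH : Subgroup.center G ≤ H) :
    ∃ s, Nat.card H = 2 ^ s * Nat.card (Subgroup.center G) := by
  have : Fact (Nat.Prime 2) := ⟨Nat.prime_two⟩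
  have hp : IsPGroup 2 (H ⧸ (Subgroup.center G).subgroupOf H) := by
    intro x
    obtain ⟨x, rfl⟩ := QuotientGroup.mk_surjective x
    refine ⟨1, ?_⟩
    rw [pow_one, ← QuotientGroup.mk_pow, QuotientGroup.eq_one_iff, Subgroup.mem_subgroupOf,
      pow_two]
    exact hsq x
  obtain ⟨s, hs⟩ := IsPGroup.iff_card.1 hp
  refine ⟨s, ?_⟩
  rw [Subgroup.card_eq_card_quotient_mul_card_subgroup ((Subgroup.center G).subgroupOf H), hs,
    Nat.card_congr (Subgroup.subgroupOfEquivOfLe hH).toEquiv]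

/-- If x² is not central, x and x⁻¹ are commuting elements of distinct noncentral cosets with the
same centralizer, so the common centralizer has order c as well as e. -/
theorem mul_self_mem_center_of_card_centralizers {c e : ℕ} (hce : e ≠ c)
    (h1 : ∀ g : G, g ∉ Subgroup.center G → Nat.card (Subgroup.centralizer {g}) = c)
    (h2 : ∀ g h : G, g ∉ Subgroup.center G → h ∉ Subgroup.center G →
      g⁻¹ * h ∉ Subgroup.center G → g * h = h * g →
      Nat.card (Subgroup.centralizer {g} ⊓ Subgroup.centralizer {h} : Subgroup G) = e)
    (x : G) : x * x ∈ Subgroup.center G := by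
  by_contra hx
  have hx1 : x ∉ Subgroup.center G := fun h => hx (mul_mem h h)
  have := h2 x x⁻¹ hx1 (by simpa using hx1)
    (fun h => hx (by rw [← mul_inv_rev] at h; exact inv_mem_iff.1 h)) (by simp)
  rw [show Subgroup.centralizer {x⁻¹} = Subgroup.centralizer {x} from ?_, inf_idem, h1 x hx1]
    at this
  · exact hce this.symm
  · ext y
    rw [mem_centralizer_singleton_iff_commute, mem_centralizer_singleton_iff_commute]
    exact Commute.inv_left_iff

theorem card_le_of_forall_mem_center_or [Finite G] (D : Subgroup G) (x : G)
    (h : ∀ w ∈ D, w ∈ Subgroup.center G ∨ x⁻¹ * w ∈ Subgroup.center G) :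
    Nat.card D ≤ 2 * Nat.card (Subgroup.center G) := by
  have hsub : (D : Set G) ⊆ (Subgroup.center G : Set G) ∪
      (fun z => x * z) '' (Subgroup.center G : Set G) := by
    intro w hw
    rcases h w hw with h | h
    · exact Or.inl h
    · exact Or.inr ⟨_, h, by simp⟩
  have h1 := Set.ncard_le_ncard hsub (Set.toFinite _)
  have h2 := Set.ncard_union_le (Subgroup.center G : Set G)
    ((fun z => x * z) '' (Subgroup.center G : Set G))
  rw [Set.ncard_image_of_injective _ (mul_right_injective x)] at h2
  simp only [← Nat.card_coe_set_eq, SetLike.coe_sort_coe] at h1 h2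
  omega

/-- If noncommuting elements have the smallest possible common centralizer, then commuting ones
have a small common centralizer as well. -/
theorem common_centralizer_card_le_four [Finite G] {e : ℕ}
    (h1 : ∀ g : G, g ∉ Subgroup.center G →
      Nat.card (Subgroup.centralizer {g}) = 2 * e * Nat.card (Subgroup.center G))
    (h2 : ∀ g h : G, g ∉ Subgroup.center G → h ∉ Subgroup.center G →
      g⁻¹ * h ∉ Subgroup.center G → g * h = h * g →
      Nat.card (Subgroup.centralizer {g} ⊓ Subgroup.centralizer {h} : Subgroup G) =
        e * Nat.card (Subgroup.center G))
    (h3 : ∀ g h : G, g * h ≠ h * g →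
      Nat.card (Subgroup.centralizer {g} ⊓ Subgroup.centralizer {h} : Subgroup G) =
        2 * Nat.card (Subgroup.center G))
    {x y : G} (hx : x ∉ Subgroup.center G) (hy : y ∉ Subgroup.center G)
    (hxy : x⁻¹ * y ∉ Subgroup.center G) (hc : x * y = y * x) : e ≤ 4 := by
  have hz : 0 < Nat.card (Subgroup.center G) := Nat.card_pos
  have hle : ∀ g h : G, Subgroup.center G ≤ Subgroup.centralizer {g} ⊓ Subgroup.centralizer {h} :=
    fun g h => le_inf (center_le_centralizer_singleton g) (center_le_centralizer_singleton h)
  -- The common centralizer of x and y is abelian: if p, q in it did not commute, C(p) ∩ C(q) would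
  -- contain the center with index 2 and also x and y, so x and y would share a coset.
  have hab : ∀ y : G, y ∉ Subgroup.center G → x⁻¹ * y ∉ Subgroup.center G → x * y = y * x →
      ∀ p ∈ Subgroup.centralizer {x} ⊓ Subgroup.centralizer {y},
      ∀ q ∈ Subgroup.centralizer {x} ⊓ Subgroup.centralizer {y}, p * q = q * p := by
    intro y hy hxy hc p hp q hq
    by_contra hpq
    simp only [Subgroup.mem_inf, mem_centralizer_singleton_iff_commute] at hp hq
    refine hxy (Subgroup.inv_mul_mem_of_card_eq_two_mul (hle p q) (h3 p q hpq) ?_ ?_ hx hy)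
    · simp only [Subgroup.mem_inf, mem_centralizer_singleton_iff_commute]
      exact ⟨hp.1.symm, hq.1.symm⟩
    · simp only [Subgroup.mem_inf, mem_centralizer_singleton_iff_commute]
      exact ⟨hp.2.symm, hq.2.symm⟩
  have hepos : 0 < e := by
    have := h2 x y hx hy hxy hc
    by_contra h0
    obtain rfl : e = 0 := by omega
    rw [zero_mul] at this
    exact Nat.card_pos.ne' this
  set M := Subgroup.centralizer {x} ⊓ Subgroup.centralizer {y} with hM
  have hMc : Nat.card M = e * Nat.card (Subgroup.center G) := h2 x y hx hy hxy hc
  -- M has index 2 in C(x); an element t of C(x) outside M yields a second abelian subgroup M' =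
  -- C(x) ∩ C(t) of index 2.
  obtain ⟨t, ht, htM⟩ : ∃ t ∈ Subgroup.centralizer {x}, t ∉ M := by
    by_contra! hcon
    have h := Subgroup.card_le_of_le (show Subgroup.centralizer {x} ≤ M from hcon)
    rw [hMc, h1 x hx] at h
    nlinarith [Nat.mul_pos hepos hz]
  have htx := mem_centralizer_singleton_iff_commute.1 ht
  have htz : t ∉ Subgroup.center G := fun h => htM (hle x y h)
  have hxt : x⁻¹ * t ∉ Subgroup.center G := by
    intro h
    apply htM
    have hxM : x ∈ M := ⟨mem_centralizer_singleton_iff_commute.2 rfl,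
      mem_centralizer_singleton_iff_commute.2 hc.symm⟩
    simpa using mul_mem hxM (hle x y h)
  set M' := Subgroup.centralizer {x} ⊓ Subgroup.centralizer {t} with hM'
  have hMc' : Nat.card M' = e * Nat.card (Subgroup.center G) := h2 x t hx htz hxt htx
  -- An element w of M ∩ M' outside Z ∪ xZ would give M = C(x) ∩ C(w) = M', as both are abelian of
  -- the same order as C(x) ∩ C(w); but t lies in M' and not in M.
  have hD : Nat.card (M ⊓ M' : Subgroup G) ≤ 2 * Nat.card (Subgroup.center G) := by
    refine card_le_of_forall_mem_center_or _ x fun w hw => ?_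
    by_contra! hcon
    have hxw : x * w = w * x := mem_centralizer_singleton_iff_commute.1 hw.1.1
    have hcard := h2 x w hx hcon.1 hcon.2 hxw
    have e1 : M = Subgroup.centralizer {x} ⊓ Subgroup.centralizer {w} :=
      Subgroup.eq_of_le_of_card_ge (fun p hp => ⟨hp.1, mem_centralizer_singleton_iff_commute.2
        (hab y hy hxy hc w hw.1 p hp)⟩) (by rw [hcard, hMc])
    have e2 : M' = Subgroup.centralizer {x} ⊓ Subgroup.centralizer {w} :=
      Subgroup.eq_of_le_of_card_ge (fun p hp => ⟨hp.1, mem_centralizer_singleton_iff_commute.2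
        (hab t htz hxt htx w hw.2 p hp)⟩) (by rw [hcard, hMc'])
    apply htM
    rw [e1, ← e2]
    exact ⟨ht, mem_centralizer_singleton_iff_commute.2 rfl⟩
  have hr : ∀ N ≤ Subgroup.centralizer {x}, Nat.card N = e * Nat.card (Subgroup.center G) →
      N.relIndex (Subgroup.centralizer {x}) = 2 := by
    intro N hN hNc
    have := Subgroup.card_mul_relIndex_of_le hN
    rw [hNc, h1 x hx, mul_assoc 2, mul_comm 2] at this
    exact Nat.eq_of_mul_eq_mul_left (Nat.mul_pos hepos hz) this
  have hi := Subgroup.relIndex_inf_le (H := M) (K := M') (L := Subgroup.centralizer {x})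
  rw [hr M inf_le_left hMc, hr M' inf_le_left hMc'] at hi
  have hcd := Subgroup.card_mul_relIndex_of_le
    (show M ⊓ M' ≤ Subgroup.centralizer {x} from inf_le_left.trans inf_le_left)
  rw [h1 x hx] at hcd
  -- M ∩ M' has index at most 4 in C(x), so 2e|Z| ≤ 2|Z| · 4.
  have hb := Nat.mul_le_mul hD hi
  rw [hcd] at hb
  have : e * Nat.card (Subgroup.center G) ≤ 4 * Nat.card (Subgroup.center G) := by nlinarith
  exact Nat.le_of_mul_le_mul_right this hz

/-- A group is not the union of two proper subgroups, here the centralizers of x and y. -/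
theorem exists_not_commute_both {x y : G} (hx : x ∉ Subgroup.center G)
    (hy : y ∉ Subgroup.center G) : ∃ g, x * g ≠ g * x ∧ y * g ≠ g * y := by
  rw [Subgroup.mem_center_iff] at hx hy
  push Not at hx hy
  obtain ⟨a, ha⟩ := hx
  obtain ⟨b, hb⟩ := hy
  by_cases h1 : y * a = a * y
  · by_cases h2 : x * b = b * x
    · refine ⟨a * b, fun h => ha ?_, fun h => hb ?_⟩
      · rw [mul_assoc, ← h2, ← mul_assoc, ← mul_assoc, mul_left_inj] at h
        exact h.symm
      · rw [← mul_assoc, h1, mul_assoc, mul_assoc, mul_right_inj] at h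
        exact h.symm
    · exact ⟨b, h2, hb.symm⟩
  · exact ⟨a, ha.symm, h1⟩

/-- The conjugate of x by y depends only on the coset yC(x), and with index 2 there is one
nontrivial coset. So a nontrivial [x, y] is unchanged when one entry is replaced by any element not
commuting with the other; an element commuting with neither x nor x' links [x, y] to [x', y']. The
single nontrivial commutator equals its own inverse [b, a]. -/
theorem card_commutator_eq_two_of_index_centralizer (hG : ∃ x y : G, x * y ≠ y * x)
    (h : ∀ g : G, g ∉ Subgroup.center G → (Subgroup.centralizer {g}).index = 2) :
    Nat.card (commutator G) = 2 := by
  have hnc : ∀ {x y : G}, x * y ≠ y * x → x ∉ Subgroup.center G := fun {x y} hxy hx =>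
    hxy (Subgroup.mem_center_iff.1 hx y).symm
  have step : ∀ {x y g : G}, x * y ≠ y * x → x * g ≠ g * x → ⁅x, y⁆ = ⁅x, g⁆ := by
    intro x y g hy hg
    have hm := (Subgroup.mul_mem_iff_of_index_two (h x (hnc hy)) (a := y⁻¹) (b := g)).2
    simp only [inv_mem_iff, mem_centralizer_singleton_iff_commute, hy, hg, iff_self,
      true_imp_iff] at hm
    obtain ⟨c, rfl⟩ : ∃ c, g = y * c := ⟨y⁻¹ * g, by group⟩
    rw [inv_mul_cancel_left] at hm
    rw [commutatorElement_def, commutatorElement_def, mul_inv_rev]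
    have hc : c * x⁻¹ * c⁻¹ = x⁻¹ := by
      have : Commute c x⁻¹ := (show Commute x c from hm).symm.inv_right
      rw [this.eq, mul_inv_cancel_right]
    calc x * y * x⁻¹ * y⁻¹ = x * y * (c * x⁻¹ * c⁻¹) * y⁻¹ := by rw [hc]
      _ = _ := by group
  have step' : ∀ {x x' g : G}, x * g ≠ g * x → x' * g ≠ g * x' → ⁅x, g⁆ = ⁅x', g⁆ := by
    intro x x' g hx hx'
    rw [← commutatorElement_inv g x, ← commutatorElement_inv g x', step hx.symm hx'.symm]
  have hall : ∀ {x y x' y' : G}, x * y ≠ y * x → x' * y' ≠ y' * x' → ⁅x, y⁆ = ⁅x', y'⁆ := by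
    intro x y x' y' hxy hxy'
    obtain ⟨g, hg, hg'⟩ := exists_not_commute_both (hnc hxy) (hnc hxy')
    rw [step hxy hg, step hxy' hg', step' hg hg']
  obtain ⟨a, b, hab⟩ := hG
  set w := ⁅a, b⁆ with hw
  have hw1 : w ≠ 1 := fun h => hab (commutatorElement_eq_one_iff_mul_comm.1 h)
  have hw2 : w ^ 2 = 1 := by
    have : w⁻¹ = w := by rw [hw, commutatorElement_inv]; exact hall hab.symm hab
    rw [pow_two]
    nth_rewrite 1 [← this]
    simp
  have hcomm : commutator G = Subgroup.zpowers w := by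
    rw [commutator_eq_closure]
    apply le_antisymm
    · rw [Subgroup.closure_le]
      rintro _ ⟨x, y, rfl⟩
      by_cases hxy : x * y = y * x
      · rw [commutatorElement_eq_one_iff_mul_comm.2 hxy]
        exact one_mem _
      · rw [hall hxy hab]
        exact Subgroup.mem_zpowers w
    · rw [Subgroup.zpowers_le]
      exact Subgroup.subset_closure ⟨a, b, rfl⟩
  rw [hcomm, Nat.card_zpowers]
  exact orderOf_eq_prime hw2 hw1

theorem card_commutator_eq_two_of_isConnectedStronglyRegular [Finite G] {T : Set G}
    (hG : ∃ x y : G, x * y ≠ y * x)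
    (hT : Subgroup.IsComplement T (Subgroup.center G : Set G))
    (h : IsConnectedStronglyRegular (transversalGraph T)) :
    Nat.card (commutator G) = 2 ∧ 16 * Nat.card (Subgroup.center G) ≤ Nat.card G := by
  obtain ⟨hconn, v, k, l, m, hsrg⟩ := h
  obtain ⟨g, t, i, ht, hgt, hti, hgi⟩ := exists_commuting_path_of_connected hT hG hconn
  obtain ⟨hk, hkv, hv, h1, h2, h3⟩ := (isStronglyRegular_transversalGraph_iff hT v k l m).1 hsrg
  have hz : 0 < Nat.card (Subgroup.center G) := Nat.card_pos
  have hg : g ∉ Subgroup.center G := fun hg => hgi (Subgroup.mem_center_iff.1 hg i).symm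
  have hgt' : g⁻¹ * t ∉ Subgroup.center G := by
    intro h
    have e := centralizer_singleton_eq_of_inv_mul_mem_center h
    have : i ∈ Subgroup.centralizer {t} := mem_centralizer_singleton_iff_commute.2 hti
    rw [← e, mem_centralizer_singleton_iff_commute] at this
    exact hgi this
  have hle : ∀ g h : G, Subgroup.center G ≤ Subgroup.centralizer {g} ⊓ Subgroup.centralizer {h} :=
    fun g h => le_inf (center_le_centralizer_singleton g) (center_le_centralizer_singleton h)
  -- Both strict inequalities come from the path g, t, i: the element i lies in C(t) but not in
  -- C(g), and t is a noncentral element of C(g) ∩ C(i).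
  have hlk : l + 3 < k + 2 := by
    have hlt : Subgroup.centralizer {g} ⊓ Subgroup.centralizer {t} < Subgroup.centralizer {t} := by
      refine lt_of_le_of_ne inf_le_right fun e => hgi ?_
      have : i ∈ Subgroup.centralizer {t} := mem_centralizer_singleton_iff_commute.2 hti
      rw [← e] at this
      exact mem_centralizer_singleton_iff_commute.1 this.1
    have := Set.ncard_lt_ncard (show (_ : Set G) ⊂ _ from hlt) (Set.toFinite _)
    rw [← Nat.card_coe_set_eq, ← Nat.card_coe_set_eq] at this
    simp only [SetLike.coe_sort_coe] at this
    rw [h2 g t hg ht hgt' hgt, h1 t ht] at this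
    exact lt_of_mul_lt_mul_right this hz.le
  have hm : 2 ≤ m + 1 := by
    have hlt : Subgroup.center G < Subgroup.centralizer {g} ⊓ Subgroup.centralizer {i} := by
      refine lt_of_le_of_ne (hle g i) fun e => ht ?_
      rw [e]
      exact ⟨mem_centralizer_singleton_iff_commute.2 hgt,
        mem_centralizer_singleton_iff_commute.2 hti.symm⟩
    have := Set.ncard_lt_ncard (show (_ : Set G) ⊂ _ from hlt) (Set.toFinite _)
    rw [← Nat.card_coe_set_eq, ← Nat.card_coe_set_eq] at this
    simp only [SetLike.coe_sort_coe] at this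
    rw [h3 g i hgi] at this
    have : 1 * Nat.card (Subgroup.center G) < (m + 1) * Nat.card (Subgroup.center G) := by
      rwa [one_mul]
    exact lt_of_mul_lt_mul_right this hz.le
  have hsq := mul_self_mem_center_of_card_centralizers (e := (l + 3) * Nat.card (Subgroup.center G))
    (c := (k + 2) * Nat.card (Subgroup.center G))
    (fun e => hlk.ne (Nat.eq_of_mul_eq_mul_right hz e)) h1 h2
  have hpow : ∀ (H : Subgroup G) (r : ℕ), Subgroup.center G ≤ H →
      Nat.card H = r * Nat.card (Subgroup.center G) → ∃ s, r = 2 ^ s := by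
    intro H r hH hr
    obtain ⟨s, hs⟩ := exists_card_eq_two_pow_mul_card_center hsq H hH
    exact ⟨s, Nat.eq_of_mul_eq_mul_right hz (hr.symm.trans hs)⟩
  have hcp := hpow _ _ (center_le_centralizer_singleton g) (h1 g hg)
  have hep := hpow _ _ (hle g t) (h2 g t hg ht hgt' hgt)
  have hdp := hpow _ _ (hle g i) (h3 g i hgi)
  have hqp := hpow ⊤ _ le_top (by rw [Subgroup.card_top, hv])
  -- A power of 2 that is at least 3 is at least 4.
  have he4 : 4 ≤ l + 3 := by
    obtain ⟨s, hs⟩ := hep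
    rcases Nat.lt_or_ge s 2 with hs2 | hs2
    · interval_cases s <;> omega
    · rw [hs]
      calc 4 = 2 ^ 2 := rfl
        _ ≤ 2 ^ s := Nat.pow_le_pow_right (by norm_num) hs2
  have hparam := hsrg.param_eq
  obtain ⟨hce, hq⟩ := eq_of_two_pow_param_eq hcp hep hdp hqp he4 hlk (by omega) hm (by
    rw [show k + 2 - 2 = k by omega, show k + 2 - (l + 3) = k - l - 1 by omega,
      show v + 1 - (k + 2) = v - k - 1 by omega, show m + 1 - 1 = m by omega]
    exact hparam)
  rcases hq with hq | ⟨hd, hq⟩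
  · refine ⟨card_commutator_eq_two_of_index_centralizer hG fun g hg => ?_, ?_⟩
    · have := Subgroup.card_mul_index (Subgroup.centralizer {g})
      rw [hv, hq, mul_assoc, ← h1 g hg, mul_comm] at this
      exact Nat.eq_of_mul_eq_mul_right Nat.card_pos this
    · rw [hv]
      exact Nat.mul_le_mul_right _ (by omega)
  · exfalso
    have : l + 3 ≤ 4 := by
      refine common_centralizer_card_le_four (e := l + 3) ?_ h2 ?_ hg ht hgt' hgt
      · intro g hg
        rw [h1 g hg, hce]
      · intro g h hgh
        rw [h3 g h hgh, hd]
    obtain rfl : l = 1 := by omega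
    obtain rfl : k = 6 := by omega
    obtain rfl : m = 1 := by omega
    obtain rfl : v = 31 := by omega
    exact not_isStronglyRegular_31_6_1_1 _ hsrg

end

/-! ### Groups with derived subgroup of order 2 -/

section

variable {G : Type*} [Group G]

theorem Subgroup.eq_of_card_eq_two [Finite G] {H : Subgroup G} (hH : Nat.card H = 2) {a b : G}
    (ha : a ∈ H) (hb : b ∈ H) (ha1 : a ≠ 1) (hb1 : b ≠ 1) : a = b := by
  have := Subgroup.inv_mul_mem_of_card_eq_two_mul (H := ⊥) (K := H) bot_le (by simp [hH])
    ha hb (by simpa using ha1) (by simpa using hb1)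
  rw [Subgroup.mem_bot, inv_mul_eq_one] at this
  exact this

theorem commutatorElement_mem_commutator (x y : G) : ⁅x, y⁆ ∈ commutator G :=
  Subgroup.commutator_mem_commutator (Subgroup.mem_top x) (Subgroup.mem_top y)

theorem commutator_eq_bot_of_forall_commute (h : ∀ x y : G, x * y = y * x) :
    commutator G = ⊥ := by
  rw [commutator_eq_closure, Subgroup.closure_eq_bot_iff]
  rintro _ ⟨x, y, rfl⟩
  exact commutatorElement_eq_one_iff_mul_comm.2 (h x y)

theorem exists_not_commute_of_card_commutator_eq_two (h : Nat.card (commutator G) = 2) :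
    ∃ x y : G, x * y ≠ y * x := by
  by_contra! hcon
  rw [commutator_eq_bot_of_forall_commute hcon, Subgroup.card_bot] at h
  omega

theorem commutator_le_center_of_card_eq_two [Finite G] (h : Nat.card (commutator G) = 2) :
    commutator G ≤ Subgroup.center G := by
  intro w hw
  rw [Subgroup.mem_center_iff]
  intro g
  by_cases hw1 : w = 1
  · simp [hw1]
  · have hconj : g * w * g⁻¹ ∈ commutator G :=
      (inferInstance : (commutator G).Normal).conj_mem w hw g
    have := Subgroup.eq_of_card_eq_two h hconj hw (by simpa using hw1) hw1
    exact mul_inv_eq_iff_eq_mul.1 this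

theorem commutatorElement_mul_right_of_le_center (hG : commutator G ≤ Subgroup.center G)
    (x y z : G) : ⁅x, y * z⁆ = ⁅x, y⁆ * ⁅x, z⁆ := by
  rw [commutatorElement_mul_right_eq_mul_conj]
  have := Subgroup.mem_center_iff.1 (hG (commutatorElement_mem_commutator x z)) y
  rw [mul_assoc _ y, this]
  group

theorem commutatorElement_mul_left_of_le_center (hG : commutator G ≤ Subgroup.center G)
    (x y z : G) : ⁅x * y, z⁆ = ⁅x, z⁆ * ⁅y, z⁆ := by
  rw [commutatorElement_mul_left_eq_conj_mul]
  have := Subgroup.mem_center_iff.1 (hG (commutatorElement_mem_commutator y z))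
  rw [this x, mul_inv_cancel_right, this]

/-- The centralizer of x is the kernel of the homomorphism g ↦ [x, g] onto the group G' of order 2.
-/
theorem index_centralizer_eq_two [Finite G] (h : Nat.card (commutator G) = 2) {x : G}
    (hx : x ∉ Subgroup.center G) : (Subgroup.centralizer {x}).index = 2 := by
  rw [Subgroup.mem_center_iff] at hx
  push Not at hx
  obtain ⟨a, ha⟩ := hx
  rw [Subgroup.index_eq_two_iff]
  refine ⟨a, fun b => ?_⟩
  simp only [mem_centralizer_singleton_iff_commute, ← commutatorElement_eq_one_iff_mul_comm]
  rw [commutatorElement_mul_right_of_le_center (commutator_le_center_of_card_eq_two h)]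
  have ha1 : ⁅x, a⁆ ≠ 1 := fun h => ha (commutatorElement_eq_one_iff_mul_comm.1 h).symm
  by_cases hb : ⁅x, b⁆ = 1
  · right
    simpa [hb] using ha1
  · left
    refine ⟨?_, hb⟩
    have hinv : (⁅x, a⁆)⁻¹ = ⁅x, b⁆ := Subgroup.eq_of_card_eq_two h
      (inv_mem (commutatorElement_mem_commutator x a)) (commutatorElement_mem_commutator x b)
      (inv_ne_one.2 ha1) hb
    rw [← hinv, inv_mul_cancel]

theorem mul_self_mem_center_of_card_commutator_eq_two [Finite G]
    (h : Nat.card (commutator G) = 2) (x : G) : x * x ∈ Subgroup.center G := by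
  rw [Subgroup.mem_center_iff]
  intro g
  by_cases hg : g ∈ Subgroup.center G
  · exact (Subgroup.mem_center_iff.1 hg _).symm
  · have := Subgroup.sq_mem_of_index_two (index_centralizer_eq_two h hg) x
    rw [pow_two, mem_centralizer_singleton_iff_commute] at this
    exact this

/-- With only one nontrivial commutator value, equal centralizers give [x, g] = [y, g] for all g:
the commutator form is nondegenerate modulo the center. -/
theorem inv_mul_mem_center_of_centralizer_eq [Finite G] (h : Nat.card (commutator G) = 2) {x y : G}
    (hxy : Subgroup.centralizer {x} = Subgroup.centralizer {y}) :
    x⁻¹ * y ∈ Subgroup.center G := by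
  rw [Subgroup.mem_center_iff]
  intro g
  have hc : ⁅x, g⁆ = ⁅y, g⁆ := by
    have hiff : ⁅x, g⁆ = 1 ↔ ⁅y, g⁆ = 1 := by
      rw [commutatorElement_eq_one_iff_mul_comm, commutatorElement_eq_one_iff_mul_comm,
        ← mem_centralizer_singleton_iff_commute, ← mem_centralizer_singleton_iff_commute, hxy]
    by_cases hx : ⁅x, g⁆ = 1
    · rw [hx, hiff.1 hx]
    · exact Subgroup.eq_of_card_eq_two h (commutatorElement_mem_commutator x g)
        (commutatorElement_mem_commutator y g) hx (fun hy => hx (hiff.2 hy))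
  rw [commutatorElement_def, commutatorElement_def, mul_left_inj, mul_inv_eq_iff_eq_mul] at hc
  calc g * (x⁻¹ * y) = x⁻¹ * (x * g) * x⁻¹ * y := by group
    _ = x⁻¹ * y * g := by rw [hc]; group

/-- The two centralizers are distinct subgroups of index 2, so they meet in index 4, whether or not
x and y commute. -/
theorem card_inf_centralizer_mul_four [Finite G] (h : Nat.card (commutator G) = 2) {x y : G}
    (hx : x ∉ Subgroup.center G) (hy : y ∉ Subgroup.center G)
    (hxy : x⁻¹ * y ∉ Subgroup.center G) :
    Nat.card (Subgroup.centralizer {x} ⊓ Subgroup.centralizer {y} : Subgroup G) * 4 =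
      Nat.card G := by
  have hix := index_centralizer_eq_two h hx
  have hiy := index_centralizer_eq_two h hy
  have : (Subgroup.centralizer {x}).Normal := Subgroup.normal_of_index_eq_two hix
  have hd := Subgroup.relIndex_dvd_index_of_normal (Subgroup.centralizer {x})
    (Subgroup.centralizer {y})
  rw [hix] at hd
  have hne : (Subgroup.centralizer {x}).relIndex (Subgroup.centralizer {y}) ≠ 1 := by
    intro h1
    rw [Subgroup.relIndex_eq_one] at h1
    refine hxy (inv_mul_mem_center_of_centralizer_eq h
      (Subgroup.eq_of_le_of_card_ge h1 ?_).symm)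
    have e1 := Subgroup.card_mul_index (Subgroup.centralizer {x})
    have e2 := Subgroup.card_mul_index (Subgroup.centralizer {y})
    rw [hix] at e1
    rw [hiy] at e2
    omega
  have h2 := ((Nat.dvd_prime Nat.prime_two).1 hd).resolve_left hne
  have h3 := Subgroup.relIndex_mul_index
    (inf_le_right : Subgroup.centralizer {x} ⊓ Subgroup.centralizer {y} ≤ _)
  rw [Subgroup.inf_relIndex_right, h2, hiy] at h3
  have := Subgroup.card_mul_index (Subgroup.centralizer {x} ⊓ Subgroup.centralizer {y})
  rwa [← h3] at this

theorem isStronglyRegular_of_card_commutator_eq_two [Finite G] {T : Set G}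
    (hT : Subgroup.IsComplement T (Subgroup.center G : Set G))
    (h : Nat.card (commutator G) = 2) {r : ℕ} (hr : 4 ≤ r)
    (hq : Nat.card G = 4 * r * Nat.card (Subgroup.center G)) :
    IsStronglyRegular (transversalGraph T) (4 * r - 1) (2 * r - 2) (r - 3) (r - 1) ∧
      (transversalGraph T).Connected := by
  have hz : 0 < Nat.card (Subgroup.center G) := Nat.card_pos
  have hinf : ∀ x y : G, x ∉ Subgroup.center G → y ∉ Subgroup.center G →
      x⁻¹ * y ∉ Subgroup.center G →
      Nat.card (Subgroup.centralizer {x} ⊓ Subgroup.centralizer {y} : Subgroup G) =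
        r * Nat.card (Subgroup.center G) := by
    intro x y hx hy hxy
    have := card_inf_centralizer_mul_four h hx hy hxy
    rw [hq] at this
    linarith
  have hinf' : ∀ x y : G, x * y ≠ y * x →
      Nat.card (Subgroup.centralizer {x} ⊓ Subgroup.centralizer {y} : Subgroup G) =
        r * Nat.card (Subgroup.center G) := by
    intro x y hxy
    refine hinf x y (fun hx => hxy (Subgroup.mem_center_iff.1 hx y).symm)
      (fun hy => hxy (Subgroup.mem_center_iff.1 hy x)) fun hc => hxy ?_
    have e := centralizer_singleton_eq_of_inv_mul_mem_center hc
    have : y ∈ Subgroup.centralizer {y} := mem_centralizer_singleton_iff_commute.2 rfl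
    rw [← e] at this
    exact mem_centralizer_singleton_iff_commute.1 this
  constructor
  · rw [isStronglyRegular_transversalGraph_iff hT]
    refine ⟨by omega, by omega, ?_, fun x hx => ?_, fun x y hx hy hxy _ => ?_, fun x y hxy => ?_⟩
    · rw [hq, show 4 * r - 1 + 1 = 4 * r by omega]
    · have := Subgroup.card_mul_index (Subgroup.centralizer {x})
      rw [index_centralizer_eq_two h hx, hq] at this
      rw [show 2 * r - 2 + 2 = 2 * r by omega]
      linarith
    · rw [hinf x y hx hy hxy, show r - 3 + 3 = r by omega]
    · rw [hinf' x y hxy, show r - 1 + 1 = r by omega]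
  · refine transversalGraph_connected hT (exists_not_commute_of_card_commutator_eq_two h) ?_
    -- The common centralizer has order r|Z| > |Z|, so noncommuting vertices are joined by a path of
    -- length 2.
    intro x y hxy
    by_contra! hcon
    have hle : Subgroup.centralizer {x} ⊓ Subgroup.centralizer {y} ≤ Subgroup.center G := by
      intro i hi
      by_contra hic
      exact hcon i hic (mem_centralizer_singleton_iff_commute.1 hi.1)
        (mem_centralizer_singleton_iff_commute.1 hi.2)
    have := Subgroup.card_le_of_le hle
    rw [hinf' x y hxy] at this
    nlinarith

theorem isCoatom_of_index_eq_two {H : Subgroup G} (h : H.index = 2) : IsCoatom H := by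
  refine ⟨fun e => by simp [e] at h, fun K hK => ?_⟩
  obtain ⟨k, hk, hkH⟩ := SetLike.exists_of_lt hK
  rw [eq_top_iff]
  intro g _
  by_cases hg : g ∈ H
  · exact hK.le hg
  · have := (Subgroup.mul_mem_iff_of_index_two h (a := k) (b := g)).2 (by simp [hkH, hg])
    exact (Subgroup.mul_mem_cancel_left K hk).1 (hK.le this)

theorem commutator_le_of_forall_exists_center_mul {P : Subgroup G}
    (hP : ∀ g : G, ∃ a ∈ Subgroup.center G, ∃ p ∈ P, a * p = g) : commutator G ≤ ⁅P, P⁆ := by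
  rw [commutator_eq_closure, Subgroup.closure_le]
  rintro _ ⟨x, y, rfl⟩
  obtain ⟨a, ha, p, hp, rfl⟩ := hP x
  obtain ⟨b, hb, q, hq, rfl⟩ := hP y
  have : ⁅a * p, b * q⁆ = ⁅p, q⁆ := by
    have e1 : Commute a (b * q) := ((Subgroup.mem_center_iff.1 ha (b * q)).symm)
    have e2 : Commute b p := ((Subgroup.mem_center_iff.1 hb p).symm)
    rw [commutatorElement_mul_left_eq_conj_mul, commutatorElement_eq_one_iff_commute.2 e1, mul_one,
      commutatorElement_mul_right_eq_mul_conj, commutatorElement_eq_one_iff_commute.2 e2.symm,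
      one_mul]
    have e3 : ∀ g : G, a * g = g * a := fun g => (Subgroup.mem_center_iff.1 ha g).symm
    have e4 : ∀ g : G, b * g = g * b := fun g => (Subgroup.mem_center_iff.1 hb g).symm
    rw [e4, e3]
    group
  rw [this]
  exact Subgroup.commutator_mem_commutator hp hq

/-- A maximal subgroup M not containing Z would satisfy ZM = G, hence Z = G' = M' ≤ M. Conversely,
centralizers of noncentral elements are maximal, having index 2, and they intersect in the center.
-/
theorem isExtraspecial_two_of_card [Finite G] (h : Nat.card (commutator G) = 2)
    (hz : Nat.card (Subgroup.center G) = 2) : IsExtraspecial 2 G := by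
  have hcz : commutator G = Subgroup.center G :=
    Subgroup.eq_of_le_of_card_ge (commutator_le_center_of_card_eq_two h) (by rw [h, hz])
  refine ⟨Nat.prime_two, inferInstance, ?_, exists_not_commute_of_card_commutator_eq_two h, hcz,
    le_antisymm ?_ ?_, hz⟩
  · intro x
    refine ⟨2, ?_⟩
    have : (⟨x * x, mul_self_mem_center_of_card_commutator_eq_two h x⟩ :
        Subgroup.center G) ^ Nat.card (Subgroup.center G) = 1 := pow_card_eq_one'
    rw [hz] at this
    have := congrArg Subtype.val this
    simp only [Subgroup.coe_pow, Subgroup.coe_one] at this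
    rwa [← pow_two, ← pow_mul] at this
  · rw [frattini, Order.radical]
    refine le_iInf₂ fun M hM => ?_
    by_contra hcon
    have htop : Subgroup.center G ⊔ M = ⊤ := hM.2 _ (right_lt_sup.2 hcon)
    have hle := commutator_le_of_forall_exists_center_mul (P := M) fun g => by
      have hg : g ∈ Subgroup.center G ⊔ M := by rw [htop]; trivial
      exact Subgroup.mem_sup_of_normal_left.1 hg
    exact hcon (hcz ▸ hle.trans M.commutator_le_self)
  · intro x hx
    rw [Subgroup.mem_center_iff]
    intro y
    by_cases hy : y ∈ Subgroup.center G
    · exact (Subgroup.mem_center_iff.1 hy x).symm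
    · exact mem_centralizer_singleton_iff_commute.1
        (frattini_le_coatom (isCoatom_of_index_eq_two (index_centralizer_eq_two h hy)) hx)

end

/-! ### Isoclinisms and the splitting off of a Sylow 2-subgroup -/

section Isoclinism

theorem Isoclinic.symm {G H : Type*} [Group G] [Group H] (h : Isoclinic G H) : Isoclinic H G := by
  obtain ⟨φ, ψ, hc⟩ := h
  exact ⟨⟨φ.symm, ψ.symm, fun a b => by rw [MulEquiv.symm_apply_eq, hc]; simp⟩⟩

theorem Isoclinic.trans {G H K : Type*} [Group G] [Group H] [Group K] (h : Isoclinic G H)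
    (h' : Isoclinic H K) : Isoclinic G K := by
  obtain ⟨φ, ψ, hc⟩ := h
  obtain ⟨φ', ψ', hc'⟩ := h'
  exact ⟨⟨φ.trans φ', ψ.trans ψ', fun a b => by simp [hc, hc']⟩⟩

theorem Isoclinic.card_commutator_eq {G H : Type*} [Group G] [Group H] (h : Isoclinic G H) :
    Nat.card (commutator G) = Nat.card (commutator H) := by
  obtain ⟨i⟩ := h
  exact Nat.card_congr i.ψ.toEquiv

theorem Isoclinic.card_quotient_center_eq {G H : Type*} [Group G] [Group H] (h : Isoclinic G H) :
    Nat.card (G ⧸ Subgroup.center G) = Nat.card (H ⧸ Subgroup.center H) := by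
  obtain ⟨i⟩ := h
  exact Nat.card_congr i.φ.toEquiv

/-- Groups of order 2 have a single isomorphism between them, so compatibility only concerns which
commutators are trivial. -/
theorem isoclinic_of_card_commutator_eq_two {G H : Type*} [Group G] [Group H] [Finite H]
    (hG : Nat.card (commutator G) = 2) (hH : Nat.card (commutator H) = 2)
    (φ : (G ⧸ Subgroup.center G) ≃* (H ⧸ Subgroup.center H))
    (hφ : ∀ a b, commutatorMap G a b = 1 ↔ commutatorMap H (φ a) (φ b) = 1) :
    Isoclinic G H := by
  have : Fact (Nat.Prime 2) := ⟨Nat.prime_two⟩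
  refine ⟨⟨φ, mulEquivOfPrimeCardEq hG hH, fun a b => ?_⟩⟩
  by_cases h : commutatorMap G a b = 1
  · rw [h, map_one, (hφ a b).1 h]
  · apply Subtype.ext
    refine Subgroup.eq_of_card_eq_two hH (Subtype.prop _) (Subtype.prop _) ?_ ?_
    · simpa using h
    · simpa using fun h' => h ((hφ a b).2 h')

/-- When G = Z(G)P, the inclusion of P induces both isomorphisms: Z(P) = P ∩ Z(G), and central
factors do not affect commutators. -/
theorem isoclinic_of_forall_exists_center_mul {G : Type*} [Group G] (P : Subgroup G)
    (hP : ∀ g : G, ∃ a ∈ Subgroup.center G, ∃ p ∈ P, a * p = g) : Isoclinic P G := by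
  let f : P →* G ⧸ Subgroup.center G := (QuotientGroup.mk' (Subgroup.center G)).comp P.subtype
  have hf : Function.Surjective f := by
    intro y
    obtain ⟨y, rfl⟩ := QuotientGroup.mk_surjective y
    obtain ⟨a, ha, p, hp, rfl⟩ := hP y
    refine ⟨⟨p, hp⟩, ?_⟩
    change (p : G ⧸ Subgroup.center G) = ((a * p : G) : G ⧸ Subgroup.center G)
    rw [QuotientGroup.eq, ← Subgroup.mem_center_iff.1 ha p, inv_mul_cancel_left]
    exact ha
  have hker : f.ker = Subgroup.center P := by
    ext p
    have : p ∈ f.ker ↔ (p : G) ∈ Subgroup.center G := by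
      rw [MonoidHom.mem_ker]
      exact QuotientGroup.eq_one_iff _
    rw [this, Subgroup.mem_center_iff, Subgroup.mem_center_iff]
    constructor
    · exact fun h q => Subtype.ext (h q)
    · intro h g
      obtain ⟨a, ha, q, hq, rfl⟩ := hP g
      have e1 : q * p = p * q := congrArg Subtype.val (h ⟨q, hq⟩)
      rw [mul_assoc, e1, ← Subgroup.mem_center_iff.1 ha, mul_assoc,
        Subgroup.mem_center_iff.1 ha q]
  have hcomm : (commutator P).map P.subtype = commutator G := by
    rw [Subgroup.map_subtype_commutator]
    exact le_antisymm (Subgroup.commutator_mono le_top le_top)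
      (commutator_le_of_forall_exists_center_mul hP)
  refine ⟨⟨(QuotientGroup.quotientMulEquivOfEq hker.symm).trans
    (QuotientGroup.quotientKerEquivOfSurjective f hf),
    ((commutator P).equivMapOfInjective P.subtype P.subtype_injective).trans
      (MulEquiv.subgroupCongr hcomm), fun a b => ?_⟩⟩
  obtain ⟨x, rfl⟩ := QuotientGroup.mk_surjective a
  obtain ⟨y, rfl⟩ := QuotientGroup.mk_surjective b
  apply Subtype.ext
  rfl

/-- A finite group with derived subgroup of order `2` is the direct product of an abelian group and
a Sylow `2`-subgroup. -/
theorem exists_isInternalDirectProduct_sylow_two {G : Type*} [Group G] [Finite G]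
    (h : Nat.card (commutator G) = 2) :
    ∃ (A : Subgroup G) (P : Sylow 2 G), (∀ a ∈ A, ∀ b ∈ A, a * b = b * a) ∧
      IsInternalDirectProduct A (P : Subgroup G) := by
  have : Fact (Nat.Prime 2) := ⟨Nat.prime_two⟩
  have P : Sylow 2 G := default
  have hcP : commutator G ≤ P := by
    have hp : IsPGroup 2 (commutator G) := IsPGroup.of_card (n := 1) (by rw [h, pow_one])
    exact hp.le_sylow_of_normal P
  have hPn : (P : Subgroup G).Normal := ⟨fun p hp g => by
    have := mul_mem (hcP (commutatorElement_mem_commutator g p)) hp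
    rwa [commutatorElement_def, inv_mul_cancel_right] at this⟩
  have h2 : ¬ 2 ∣ (P : Subgroup G).index := P.not_dvd_index
  obtain ⟨m, hm⟩ := IsPGroup.iff_card.1 P.isPGroup'
  obtain ⟨A, hA⟩ := Subgroup.exists_left_complement'_of_coprime (N := (P : Subgroup G)) (by
    rw [hm]
    exact Nat.Coprime.pow_left m ((Nat.Prime.coprime_iff_not_dvd Nat.prime_two).2 h2))
  -- An element of odd order 2k+1 or a divisor of it is the inverse of (a²)^k, and squares are
  -- central.
  have hAc : A ≤ Subgroup.center G := by
    intro a ha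
    have hodd : Odd (Nat.card A) := by
      rw [← hA.index_eq_card, ← Nat.not_even_iff_odd, even_iff_two_dvd]
      exact h2
    obtain ⟨k, hk⟩ := hodd
    have hpow : a ^ (2 * k + 1) = 1 := by
      rw [← hk]
      exact congrArg Subtype.val (pow_card_eq_one' (x := (⟨a, ha⟩ : A)))
    have hsq := pow_mem (mul_self_mem_center_of_card_commutator_eq_two h a) k
    rw [pow_succ, pow_mul, pow_two, mul_eq_one_iff_inv_eq] at hpow
    rw [← hpow]
    exact inv_mem hsq
  refine ⟨A, P, fun a ha b hb => (Subgroup.mem_center_iff.1 (hAc hb) a), ⟨⟨fun a ha g => ?_⟩, hPn,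
    hA.isCompl.inf_eq_bot, hA.sup_eq_top⟩⟩
  rw [Subgroup.mem_center_iff.1 (hAc ha) g, mul_inv_cancel_right]
  exact ha

theorem isoclinic_of_isInternalDirectProduct {G : Type*} [Group G] {A P : Subgroup G}
    (hA : ∀ a ∈ A, ∀ b ∈ A, a * b = b * a) (h : IsInternalDirectProduct A P) :
    Isoclinic P G := by
  have hmem : ∀ g : G, ∃ a ∈ A, ∃ p ∈ P, a * p = g := fun g => by
    have := h.normal_right
    have hg : g ∈ A ⊔ P := by rw [h.sup_eq_top]; trivial
    exact Subgroup.mem_sup_of_normal_right.1 hg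
  refine isoclinic_of_forall_exists_center_mul P fun g => ?_
  obtain ⟨a, ha, p, hp, rfl⟩ := hmem g
  refine ⟨a, Subgroup.mem_center_iff.2 fun g => ?_, p, hp, rfl⟩
  obtain ⟨b, hb, q, hq, rfl⟩ := hmem g
  have e : Commute a q := Subgroup.commute_of_normal_of_disjoint A P h.normal_left h.normal_right
    (disjoint_iff.2 h.inf_eq_bot) a q ha hq
  rw [mul_assoc, ← e.eq, ← mul_assoc, hA b hb a ha, mul_assoc]

end Isoclinism

/-! ### Alternating forms over `ZMod 2` and the central extensions they define -/

section AlternatingForms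

variable {N : ℕ} (B : LinearMap.BilinForm (ZMod 2) (Fin N → ZMod 2))

theorem bilinForm_symm_of_alternating (hB : ∀ v, B v v = 0) (v w : Fin N → ZMod 2) :
    B v w = B w v := by
  have := hB (v + w)
  simp only [map_add, LinearMap.add_apply, hB, zero_add, add_zero] at this
  rw [← sub_eq_zero, CharTwo.sub_eq_add, add_comm]
  exact this

/-- Take f to be the strictly upper triangular half of the Gram matrix of B; the diagonal of B
vanishes. As a cocycle, f defines an extension with commutator form B. -/
theorem exists_bilinForm_add_flip_eq (hB : ∀ v, B v v = 0) :
    ∃ f : LinearMap.BilinForm (ZMod 2) (Fin N → ZMod 2), ∀ v w, f v w + f w v = B v w := by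
  let e : Fin N → Fin N → ZMod 2 := fun i j => B (Pi.single i 1) (Pi.single j 1)
  have hsymm := bilinForm_symm_of_alternating B hB
  let f : LinearMap.BilinForm (ZMod 2) (Fin N → ZMod 2) :=
    Matrix.toBilin' (Matrix.of fun i j => if i < j then e i j else 0)
  refine ⟨f, fun v w => ?_⟩
  have h : f + f.flip = B := by
    refine LinearMap.BilinForm.ext_basis (Pi.basisFun (ZMod 2) (Fin N)) fun i j => ?_
    simp only [Pi.basisFun_apply, LinearMap.add_apply, f,
      Matrix.toBilin'_single, Matrix.of_apply]
    rcases lt_trichotomy i j with hij | rfl | hij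
    · simp [hij, hij.not_gt, e]
    · simp [hB]
    · simp [hij, hij.not_gt, e, hsymm]
  rw [← h]
  rfl

/-- A maximal totally isotropic subspace W equals its orthogonal, since B x x = 0 allows any x
orthogonal to W to be adjoined. Nondegeneracy then gives N = 2 dim W. -/
theorem exists_eq_two_mul_of_alternating (hB : ∀ v, B v v = 0)
    (hnd : ∀ v, (∀ w, B v w = 0) → v = 0) : ∃ n, N = 2 * n := by
  have hsymm := bilinForm_symm_of_alternating B hB
  obtain ⟨W, hW⟩ := Set.Finite.exists_maximal
    (s := {W : Submodule (ZMod 2) (Fin N → ZMod 2) | ∀ v ∈ W, ∀ w ∈ W, B v w = 0})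
    (Set.toFinite _) ⟨⊥, by
      intro v hv w _
      rw [(Submodule.mem_bot _).1 hv, map_zero, LinearMap.zero_apply]⟩
  have hWW : B.orthogonal W = W := by
    apply le_antisymm
    · intro x hx
      rw [LinearMap.BilinForm.mem_orthogonal_iff] at hx
      have hx' : ∀ v ∈ W, B v x = 0 := hx
      have hmem : W ⊔ Submodule.span (ZMod 2) {x} ∈
          {W : Submodule (ZMod 2) (Fin N → ZMod 2) | ∀ v ∈ W, ∀ w ∈ W, B v w = 0} := by
        intro v hv w hw
        obtain ⟨v, hv₀, _, hv', rfl⟩ := Submodule.mem_sup.1 hv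
        obtain ⟨w, hw₀, _, hw', rfl⟩ := Submodule.mem_sup.1 hw
        obtain ⟨a, rfl⟩ := Submodule.mem_span_singleton.1 hv'
        obtain ⟨b, rfl⟩ := Submodule.mem_span_singleton.1 hw'
        simp only [map_add, map_smul, LinearMap.add_apply, LinearMap.smul_apply, hB,
          hW.prop v hv₀ w hw₀, hx' v hv₀, hsymm x w, hx' w hw₀]
        simp
      exact hW.le_of_ge hmem le_sup_left
        (Submodule.mem_sup_right (Submodule.mem_span_singleton_self x))
    · intro x hx
      rw [LinearMap.BilinForm.mem_orthogonal_iff]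
      exact fun v hv => hW.prop v hv x hx
  have hBn : B.Nondegenerate :=
    ⟨hnd, fun v h => hnd v fun w => by rw [hsymm]; exact h w⟩
  have := LinearMap.BilinForm.finrank_orthogonal hBn W
  have hle := Submodule.finrank_le W
  rw [hWW] at this
  rw [Module.finrank_fin_fun] at this hle
  exact ⟨Module.finrank (ZMod 2) W, by omega⟩

end AlternatingForms

/-- The central extension of `V` by `ZMod 2` defined by the bilinear cocycle `f`. -/
@[ext]
structure BilinExtension {V : Type*} [AddCommGroup V] [Module (ZMod 2) V]
    (f : LinearMap.BilinForm (ZMod 2) V) where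
  fst : V
  snd : ZMod 2

namespace BilinExtension

variable {V : Type*} [AddCommGroup V] [Module (ZMod 2) V] (f : LinearMap.BilinForm (ZMod 2) V)

instance : Mul (BilinExtension f) := ⟨fun x y => ⟨x.fst + y.fst, x.snd + y.snd + f x.fst y.fst⟩⟩
instance : One (BilinExtension f) := ⟨⟨0, 0⟩⟩
instance : Inv (BilinExtension f) := ⟨fun x => ⟨-x.fst, -x.snd + f x.fst x.fst⟩⟩

@[simp] theorem mul_fst (x y : BilinExtension f) : (x * y).fst = x.fst + y.fst := rfl
@[simp] theorem mul_snd (x y : BilinExtension f) :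
    (x * y).snd = x.snd + y.snd + f x.fst y.fst := rfl
@[simp] theorem one_fst : (1 : BilinExtension f).fst = 0 := rfl
@[simp] theorem one_snd : (1 : BilinExtension f).snd = 0 := rfl
@[simp] theorem inv_fst (x : BilinExtension f) : (x⁻¹).fst = -x.fst := rfl
@[simp] theorem inv_snd (x : BilinExtension f) : (x⁻¹).snd = -x.snd + f x.fst x.fst := rfl

instance : Group (BilinExtension f) :=
  Group.ofLeftAxioms
    (fun x y z => by
      ext
      · simp [add_assoc]
      · simp only [mul_fst, mul_snd, map_add, LinearMap.add_apply]
        ring)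
    (fun x => by ext <;> simp)
    (fun x => by
      ext
      · simp
      · simp only [mul_snd, inv_fst, inv_snd, map_neg, LinearMap.neg_apply, one_snd]
        ring)

/-- The underlying set of the extension is `V × ZMod 2`. -/
def equivProd : BilinExtension f ≃ V × ZMod 2 where
  toFun x := (x.fst, x.snd)
  invFun x := ⟨x.1, x.2⟩

instance [Finite V] : Finite (BilinExtension f) := Finite.of_equiv _ (equivProd f).symm

theorem card_eq : Nat.card (BilinExtension f) = Nat.card V * 2 := by
  rw [Nat.card_congr (equivProd f), Nat.card_prod, Nat.card_zmod]

theorem mul_comm_iff (x y : BilinExtension f) :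
    x * y = y * x ↔ f x.fst y.fst + f y.fst x.fst = 0 := by
  rw [← CharTwo.sub_eq_add, sub_eq_zero]
  constructor
  · intro h
    have := congrArg snd h
    rw [mul_snd, mul_snd, add_comm y.snd] at this
    exact add_left_cancel this
  · intro h
    ext
    · exact add_comm _ _
    · rw [mul_snd, mul_snd, h, add_comm y.snd]

/-- The projection onto `V`. -/
def proj : BilinExtension f →* Multiplicative V where
  toFun x := Multiplicative.ofAdd x.fst
  map_one' := rfl
  map_mul' _ _ := rfl

theorem proj_surjective : Function.Surjective (proj f) := fun v => ⟨⟨v.toAdd, 0⟩, rfl⟩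

theorem mem_ker_proj {x : BilinExtension f} : x ∈ (proj f).ker ↔ x.fst = 0 := by
  rw [MonoidHom.mem_ker]
  rfl

theorem card_ker_proj : Nat.card (proj f).ker = 2 := by
  rw [← Nat.card_zmod 2]
  exact Nat.card_congr
    { toFun := fun x => x.1.snd
      invFun := fun a => ⟨⟨0, a⟩, (mem_ker_proj f).2 rfl⟩
      left_inv := fun x => Subtype.ext (BilinExtension.ext ((mem_ker_proj f).1 x.2).symm rfl)
      right_inv := fun _ => rfl }

variable {f}

theorem center_eq_ker_proj (hf : ∀ v, (∀ w, f v w + f w v = 0) → v = 0) :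
    Subgroup.center (BilinExtension f) = (proj f).ker := by
  ext x
  rw [mem_ker_proj, Subgroup.mem_center_iff]
  constructor
  · intro h
    refine hf _ fun w => ?_
    exact (mul_comm_iff f x ⟨w, 0⟩).1 (h ⟨w, 0⟩).symm
  · intro h y
    rw [mul_comm_iff, h]
    simp

theorem card_commutator_eq_two [Finite V] {v w : V} (h : f v w + f w v ≠ 0) :
    Nat.card (commutator (BilinExtension f)) = 2 := by
  have hle : commutator (BilinExtension f) ≤ (proj f).ker := Abelianization.commutator_subset_ker _
  have hd := Subgroup.card_dvd_of_le hle
  rw [card_ker_proj] at hd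
  refine ((Nat.dvd_prime Nat.prime_two).1 hd).resolve_left fun h1 => h ?_
  rw [Subgroup.card_eq_one] at h1
  have := commutatorElement_mem_commutator (⟨v, 0⟩ : BilinExtension f) ⟨w, 0⟩
  rw [h1, Subgroup.mem_bot, commutatorElement_eq_one_iff_mul_comm, mul_comm_iff] at this
  exact this

end BilinExtension

/-! ### The commutator form and the extraspecial group attached to it -/

section

variable {G : Type*} [Group G]

theorem commutatorMap_mul_right (hG : commutator G ≤ Subgroup.center G)
    (a b c : G ⧸ Subgroup.center G) :
    commutatorMap G a (b * c) = commutatorMap G a b * commutatorMap G a c := by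
  obtain ⟨x, rfl⟩ := QuotientGroup.mk_surjective a
  obtain ⟨y, rfl⟩ := QuotientGroup.mk_surjective b
  obtain ⟨z, rfl⟩ := QuotientGroup.mk_surjective c
  exact Subtype.ext (commutatorElement_mul_right_of_le_center hG x y z)

theorem commutatorMap_mul_left (hG : commutator G ≤ Subgroup.center G)
    (a b c : G ⧸ Subgroup.center G) :
    commutatorMap G (a * b) c = commutatorMap G a c * commutatorMap G b c := by
  obtain ⟨x, rfl⟩ := QuotientGroup.mk_surjective a
  obtain ⟨y, rfl⟩ := QuotientGroup.mk_surjective b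
  obtain ⟨z, rfl⟩ := QuotientGroup.mk_surjective c
  exact Subtype.ext (commutatorElement_mul_left_of_le_center hG x y z)

theorem commutatorMap_self (a : G ⧸ Subgroup.center G) : commutatorMap G a a = 1 := by
  obtain ⟨x, rfl⟩ := QuotientGroup.mk_surjective a
  exact Subtype.ext (commutatorElement_self x)

theorem commutatorMap_mk_eq_one_iff {x y : G} :
    commutatorMap G (x : G ⧸ Subgroup.center G) (y : G ⧸ Subgroup.center G) = 1 ↔
      x * y = y * x := by
  rw [← commutatorElement_eq_one_iff_mul_comm, ← commutatorMap_mk, OneMemClass.coe_eq_one]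

theorem eq_one_of_forall_commutatorMap_eq_one {a : G ⧸ Subgroup.center G}
    (h : ∀ b, commutatorMap G a b = 1) : a = 1 := by
  obtain ⟨x, rfl⟩ := QuotientGroup.mk_surjective a
  rw [QuotientGroup.eq_one_iff, Subgroup.mem_center_iff]
  exact fun y => (commutatorMap_mk_eq_one_iff.1 (h y)).symm

theorem exists_mulEquiv_multiplicative_of_mul_self_eq_one {Q : Type*} [Group Q] [Finite Q]
    (h : ∀ x : Q, x * x = 1) : ∃ N : ℕ, Nonempty (Q ≃* Multiplicative (Fin N → ZMod 2)) := by
  let _ : CommGroup Q :=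
    { (inferInstance : Group Q) with
      mul_comm := fun x y => by
        have hinv : ∀ z : Q, z⁻¹ = z := fun z => inv_eq_of_mul_eq_one_left (h z)
        rw [← hinv (x * y), mul_inv_rev, hinv, hinv] }
  let _ : Module (ZMod 2) (Additive Q) :=
    AddCommGroup.zmodModule fun x => by rw [two_nsmul]; exact h x
  have : Module.Finite (ZMod 2) (Additive Q) := Module.Finite.of_finite
  exact ⟨_, ⟨(MulEquiv.toAdditive.symm
    ((Module.finBasis (ZMod 2) (Additive Q)).equivFun.toAddEquiv))⟩⟩

/-- The alternating form on the central quotient of a group with derived subgroup of order `2`. -/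
theorem exists_bilinForm_commutatorMap [Finite G] (h : Nat.card (commutator G) = 2) :
    ∃ (N : ℕ) (φ : (G ⧸ Subgroup.center G) ≃* Multiplicative (Fin N → ZMod 2))
      (B : LinearMap.BilinForm (ZMod 2) (Fin N → ZMod 2)),
      ∀ a b, commutatorMap G a b = 1 ↔ B (φ a).toAdd (φ b).toAdd = 0 := by
  have : Fact (Nat.Prime 2) := ⟨Nat.prime_two⟩
  have hc := commutator_le_center_of_card_eq_two h
  obtain ⟨N, ⟨φ⟩⟩ := exists_mulEquiv_multiplicative_of_mul_self_eq_one
    (Q := G ⧸ Subgroup.center G) fun x => by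
      obtain ⟨x, rfl⟩ := QuotientGroup.mk_surjective x
      rw [← QuotientGroup.mk_mul, QuotientGroup.eq_one_iff]
      exact mul_self_mem_center_of_card_commutator_eq_two h x
  let ψ : commutator G ≃* Multiplicative (ZMod 2) := mulEquivOfPrimeCardEq h
    ((Nat.card_congr Multiplicative.toAdd).trans (Nat.card_zmod 2))
  let b : (Fin N → ZMod 2) → (Fin N → ZMod 2) → ZMod 2 := fun v w =>
    (ψ (commutatorMap G (φ.symm (Multiplicative.ofAdd v)) (φ.symm (Multiplicative.ofAdd w)))).toAdd
  have hr : ∀ v w w', b v (w + w') = b v w + b v w' := by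
    intro v w w'
    simp only [b, ofAdd_add, map_mul, commutatorMap_mul_right hc, toAdd_mul]
  have hl : ∀ v v' w, b (v + v') w = b v w + b v' w := by
    intro v v' w
    simp only [b, ofAdd_add, map_mul, commutatorMap_mul_left hc, toAdd_mul]
  let B : LinearMap.BilinForm (ZMod 2) (Fin N → ZMod 2) :=
    AddMonoidHom.toZModLinearMap 2 (AddMonoidHom.mk'
      (fun v => AddMonoidHom.toZModLinearMap 2 (AddMonoidHom.mk' (b v) (hr v)))
      fun v v' => LinearMap.ext fun w => hl v v' w)
  have hB : ∀ v w, B v w = b v w := fun _ _ => rfl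
  refine ⟨N, φ, B, fun x y => ?_⟩
  rw [hB]
  simp only [b, ofAdd_toAdd, MulEquiv.symm_apply_apply]
  rw [toAdd_eq_zero, MulEquiv.map_eq_one_iff]

/-- A finite group with derived subgroup of order `2` is isoclinic to an extraspecial group. -/
theorem exists_isExtraspecial_isoclinic [Finite G] (h : Nat.card (commutator G) = 2) :
    ∃ (n : ℕ) (E : Type) (_ : Group E), IsExtraspecial 2 E ∧ Nat.card E = 2 ^ (2 * n + 1) ∧
      Isoclinic G E ∧ Nat.card (G ⧸ Subgroup.center G) = 2 ^ (2 * n) := by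
  obtain ⟨N, φ, B, hB⟩ := exists_bilinForm_commutatorMap h
  have halt : ∀ v, B v v = 0 := fun v => by
    have := (hB (φ.symm (Multiplicative.ofAdd v)) _).1 (commutatorMap_self _)
    simpa using this
  have hnd : ∀ v, (∀ w, B v w = 0) → v = 0 := by
    intro v hv
    have : φ.symm (Multiplicative.ofAdd v) = 1 :=
      eq_one_of_forall_commutatorMap_eq_one fun b => (hB _ b).2 (by simpa using hv _)
    rw [MulEquiv.map_eq_one_iff] at this
    exact this
  obtain ⟨n, rfl⟩ := exists_eq_two_mul_of_alternating B halt hnd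
  -- The extension by f has center `ZMod 2` because f + f.flip = B is nondegenerate, and its
  -- commutator form is B.
  obtain ⟨f, hf⟩ := exists_bilinForm_add_flip_eq B halt
  have hcard : Nat.card (Fin (2 * n) → ZMod 2) = 2 ^ (2 * n) := by
    rw [Nat.card_fun, Nat.card_zmod, Nat.card_fin]
  have hcent := BilinExtension.center_eq_ker_proj (f := f) fun v hv =>
    hnd v fun w => by rw [← hf]; exact hv w
  have hE : Nat.card (commutator (BilinExtension f)) = 2 := by
    obtain ⟨x, y, hxy⟩ := exists_not_commute_of_card_commutator_eq_two h
    refine BilinExtension.card_commutator_eq_two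
      (v := (φ (x : G ⧸ Subgroup.center G)).toAdd) (w := (φ (y : G ⧸ Subgroup.center G)).toAdd) ?_
    rw [hf]
    exact fun h0 => hxy (commutatorMap_mk_eq_one_iff.1 ((hB _ _).2 h0))
  refine ⟨n, BilinExtension f, inferInstance, isExtraspecial_two_of_card hE ?_, ?_, ?_, ?_⟩
  · rw [hcent, BilinExtension.card_ker_proj]
  · rw [BilinExtension.card_eq, hcard, pow_succ]
  · let π : (BilinExtension f ⧸ Subgroup.center (BilinExtension f)) ≃*
        Multiplicative (Fin (2 * n) → ZMod 2) :=
      (QuotientGroup.quotientMulEquivOfEq hcent).trans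
        (QuotientGroup.quotientKerEquivOfSurjective _ (BilinExtension.proj_surjective f))
    have hπ : ∀ x : BilinExtension f,
        π (x : BilinExtension f ⧸ Subgroup.center (BilinExtension f)) =
          Multiplicative.ofAdd x.fst := fun _ => rfl
    refine Isoclinic.symm (isoclinic_of_card_commutator_eq_two hE h (π.trans φ.symm) ?_)
    intro a b
    obtain ⟨x, rfl⟩ := QuotientGroup.mk_surjective a
    obtain ⟨y, rfl⟩ := QuotientGroup.mk_surjective b
    rw [commutatorMap_mk_eq_one_iff, BilinExtension.mul_comm_iff, hf, hB]
    simp [hπ]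
  · rw [Nat.card_congr φ.toEquiv, Nat.card_congr Multiplicative.toAdd, hcard]

end

/-! ### Assembling the theorem -/

theorem IsExtraspecial.card_commutator_eq_of_isoclinic {G E : Type*} [Group G] [Group E]
    (hE : IsExtraspecial 2 E) (h : Isoclinic G E) : Nat.card (commutator G) = 2 := by
  rw [h.card_commutator_eq, hE.commutator_eq_center, hE.card_center]

theorem IsExtraspecial.card_quotient_center_mul_two_of_isoclinic {G E : Type*} [Group G] [Group E]
    (hE : IsExtraspecial 2 E) (h : Isoclinic G E) :
    Nat.card (G ⧸ Subgroup.center G) * 2 = Nat.card E := by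
  rw [h.card_quotient_center_eq, Subgroup.card_eq_card_quotient_mul_card_subgroup
    (Subgroup.center E), hE.card_center]

theorem isStronglyRegular_of_card_quotient_center {G : Type*} [Group G] [Finite G] {T : Set G}
    (hT : Subgroup.IsComplement T (Subgroup.center G : Set G))
    (h : Nat.card (commutator G) = 2) {n : ℕ} (hn : 2 ≤ n)
    (hq : Nat.card (G ⧸ Subgroup.center G) = 2 ^ (2 * n)) :
    IsStronglyRegular (transversalGraph T)
        (2 ^ (2 * n) - 1) (2 ^ (2 * n - 1) - 2) (2 ^ (2 * n - 2) - 3) (2 ^ (2 * n - 2) - 1) ∧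
      (transversalGraph T).Connected := by
  have e1 : 2 ^ (2 * n) = 4 * 2 ^ (2 * n - 2) := by
    rw [show (4 : ℕ) = 2 ^ 2 from rfl, ← pow_add, show 2 + (2 * n - 2) = 2 * n by omega]
  have e2 : 2 ^ (2 * n - 1) = 2 * 2 ^ (2 * n - 2) := by
    rw [show 2 * n - 1 = 2 * n - 2 + 1 by omega, pow_succ, mul_comm]
  rw [e1, e2]
  refine isStronglyRegular_of_card_commutator_eq_two hT h ?_ ?_
  · calc 4 = 2 ^ 2 := rfl
      _ ≤ 2 ^ (2 * n - 2) := Nat.pow_le_pow_right (by norm_num) (by omega)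
  · rw [← e1, ← hq, ← Subgroup.card_eq_card_quotient_mul_card_subgroup]

theorem two_le_of_sixteen_le_two_pow {n : ℕ} (h : 16 ≤ 2 ^ (2 * n)) : 2 ≤ n := by
  by_contra hlt
  interval_cases n <;> norm_num at h

theorem HasExtraspecialDecomposition.card_eq {G : Type*} [Group G] {n : ℕ}
    (h : HasExtraspecialDecomposition G n) :
    Nat.card (commutator G) = 2 ∧ Nat.card (G ⧸ Subgroup.center G) = 2 ^ (2 * n) := by
  obtain ⟨A, P, hA, hAP, E, _, hE, hcard, hiso⟩ := h
  have hG : Isoclinic G E := (isoclinic_of_isInternalDirectProduct hA hAP).symm.trans hiso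
  refine ⟨hE.card_commutator_eq_of_isoclinic hG, ?_⟩
  have := hE.card_quotient_center_mul_two_of_isoclinic hG
  rw [hcard, pow_succ] at this
  exact Nat.eq_of_mul_eq_mul_right (by norm_num) this

theorem theoremA {G : Type*} [Group G] [Finite G] (hG : ∃ x y : G, x * y ≠ y * x)
    (T : Set G) (hT : Subgroup.IsComplement T (Subgroup.center G : Set G)) :
    (IsConnectedStronglyRegular (transversalGraph T) ↔
      ∃ n : ℕ, 2 ≤ n ∧ HasExtraspecialDecomposition G n) ∧
    (∀ n : ℕ, 2 ≤ n → HasExtraspecialDecomposition G n →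
      IsStronglyRegular (transversalGraph T)
        (2 ^ (2 * n) - 1) (2 ^ (2 * n - 1) - 2) (2 ^ (2 * n - 2) - 3) (2 ^ (2 * n - 2) - 1)) ∧
    (IsConnectedStronglyRegular (transversalGraph T) ↔
      ∃ (E : Type) (_ : Group E),
        IsExtraspecial 2 E ∧ 32 ≤ Nat.card E ∧ Isoclinic G E) := by
  have hforward : IsConnectedStronglyRegular (transversalGraph T) →
      Nat.card (commutator G) = 2 ∧ ∃ (n : ℕ) (E : Type) (_ : Group E), 2 ≤ n ∧
        IsExtraspecial 2 E ∧ Nat.card E = 2 ^ (2 * n + 1) ∧ Isoclinic G E := by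
    intro h
    obtain ⟨h2, h16⟩ := card_commutator_eq_two_of_isConnectedStronglyRegular hG hT h
    obtain ⟨n, E, _, hE, hcard, hiso, hq⟩ := exists_isExtraspecial_isoclinic h2
    refine ⟨h2, n, E, inferInstance, two_le_of_sixteen_le_two_pow ?_, hE, hcard, hiso⟩
    rw [Subgroup.card_eq_card_quotient_mul_card_subgroup (Subgroup.center G), hq] at h16
    exact Nat.le_of_mul_le_mul_right h16 Nat.card_pos
  refine ⟨⟨fun h => ?_, ?_⟩, fun n hn h => ?_, fun h => ?_, ?_⟩
  · obtain ⟨h2, n, E, _, hn, hE, hcard, hiso⟩ := hforward h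
    obtain ⟨A, P, hA, hAP⟩ := exists_isInternalDirectProduct_sylow_two h2
    exact ⟨n, hn, A, P, hA, hAP, E, inferInstance, hE, hcard,
      (isoclinic_of_isInternalDirectProduct hA hAP).trans hiso⟩
  · rintro ⟨n, hn, h⟩
    obtain ⟨hsrg, hconn⟩ := isStronglyRegular_of_card_quotient_center hT h.card_eq.1 hn h.card_eq.2
    exact ⟨hconn, _, _, _, _, hsrg⟩
  · exact (isStronglyRegular_of_card_quotient_center hT h.card_eq.1 hn h.card_eq.2).1
  · obtain ⟨-, n, E, _, hn, hE, hcard, hiso⟩ := hforward h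
    refine ⟨E, inferInstance, hE, ?_, hiso⟩
    rw [hcard]
    calc 32 = 2 ^ 5 := rfl
      _ ≤ 2 ^ (2 * n + 1) := Nat.pow_le_pow_right (by norm_num) (by omega)
  · rintro ⟨E, _, hE, hcard, hiso⟩
    have h2 := hE.card_commutator_eq_of_isoclinic hiso
    -- The order of E is not assumed to be an odd power of 2; the exponent is recovered from the
    -- form on G/Z(G).
    obtain ⟨n, -, -, -, -, -, hq⟩ := exists_isExtraspecial_isoclinic h2
    rw [← hE.card_quotient_center_mul_two_of_isoclinic hiso, hq] at hcard
    obtain ⟨hsrg, hconn⟩ := isStronglyRegular_of_card_quotient_center hT h2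
      (two_le_of_sixteen_le_two_pow (by omega)) hq
    exact ⟨hconn, _, _, _, _, hsrg⟩
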